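/- Let $(G_j)_{j\ge 1}$ be an i.i.d. sequence of standard complex Gaussian random variables, meaning that the real and imaginary parts of each $G_j$ are independent real Gaussian variables with mean $0$ and variance $1$ (so the covariance matrix on $\mathbb{C}\cong\mathbb{R}^2$ is $I_2$). For $n\ge 0$ and $\theta\in[0,1)$ let $$B_n(\theta)=\sum_{j=1}^{n} G_j\, e^{2i\pi j\theta}.$$ Fix a constant $\alpha>0$, and let $\log$ denote the natural logarithm. Let $$\mathcal{D}'_\alpha=\Bigl\{\theta\in[0,1):\ |B_n(\theta)|>\sqrt{2\alpha n\log n}\ \text{ for infinitely many } n\Bigr\}.$$ Then, almost surely, the Hausdorff dimension of $\mathcal{D}'_\alpha$ is $$\dim \mathcal{D}'_\alpha=\max(1-\alpha,\,0).$$ -/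

import Mathlib

open MeasureTheory ProbabilityTheory Filter

/-- The standard complex Gaussian law: the Gaussian probability measure on `ℂ ≅ ℝ²` with mean `0`
and covariance matrix the `2 × 2` identity, so that real and imaginary parts are independent
real `N(0, 1)` variables. This is Mathlib's standard Gaussian measure on `ℂ`, seen as a Euclidean
space over `ℝ`. -/
noncomputable def stdComplexGaussian : Measure ℂ :=
  stdGaussian ℂ

/-- The walk `B_n(θ) = ∑_{j = 1}^n g_j e^{2 i π j θ}` with steps `g_1, g_2, …`.
The sequence is indexed from `0` here: `g j` is the step `g_{j + 1}`. -/
noncomputable def angularWalk (g : ℕ → ℂ) (n : ℕ) (θ : ℝ) : ℂ :=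
  ∑ j ∈ Finset.range n,
    g j * Complex.exp (2 * Complex.I * (Real.pi : ℂ) * ((j + 1 : ℕ) : ℂ) * (θ : ℂ))

/-- The threshold `φ(n) = √(2 α n log n)`. -/
noncomputable def threshold (α : ℝ) (n : ℕ) : ℝ :=
  Real.sqrt (2 * α * (n : ℝ) * Real.log (n : ℝ))

/-- The set of exceptional angles: all `θ ∈ [0, 1)` with `|B_n(θ)| > φ(n)` for infinitely
many `n`. -/
def exceptionalAngles (α : ℝ) (g : ℕ → ℂ) : Set ℝ :=
  {θ : ℝ | θ ∈ Set.Ico (0 : ℝ) 1 ∧ ∃ᶠ n : ℕ in atTop, threshold α n < ‖angularWalk g n θ‖}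

/-! For a fixed angle `B_n(θ)` is `√n` times a standard complex Gaussian, so its modulus has a
Rayleigh tail and exceeds `√(2αn log n)` with probability `n^(-α)`. The walk decorrelates at angular
distance about `1/n`, so at time `n` there are roughly `n` independent cells, of which about
`n^(1-α)` are exceptional. This predicts dimension `1 - α`. The two bounds make the heuristic
precise.

Upper bound. Along the times `i^(K+1)`, with angular mesh `i^(-(K+2))`, the walk at every
intermediate time and angle stays within `2√(i^(K+1))` of its grid value
(`ae_eventually_norm_angularWalk_le`). An exceptional angle therefore lies, for infinitely many `i`,
in a cell whose grid value exceeds the threshold of some `β < α`. The expected `s`-cost of these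
cells is finite as soon as `s > 1 - α`, with `β` close to `α` and `K` large
(`ae_tsum_largeCell_ne_top`).

Lower bound. Take `β > α` and consecutive blocks of steps so long that the past is negligible. Let
`E_k(x)` be the event that the `k`-th block walk at angle `x` reaches the `β`-level. These events
are independent over `k`, and for fixed `k` nearly independent at two angles at distance at least
`N_k^(-κ)`, `κ < 1` (`measure_norm_sum_mul_ge_and_le` with a geometric sum). The densities `∏
1_{E_k} / p_k` have mean one, and their pair correlations are at most about `|x - y|^(-a)`, `a > β`.
Second moments and Riesz energies of order `s < 1 - a` are thus bounded, and
`ae_exists_hausdorffMeasure_ne_zero` gives positive `s`-dimensional measure to a set of angles that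
are exceptional at all late block ends. -/

open scoped ENNReal NNReal Topology ComplexConjugate

/-! ### Radial integrals of the complex Gaussian -/

/-- The Gaussian radial integral over a half-line. -/
theorem lintegral_Ici_mul_exp_neg_sq {b r : ℝ} (hb : 0 < b) (hr : 0 ≤ r) :
    ∫⁻ x in Set.Ici r, ENNReal.ofReal (x * Real.exp (-b * x ^ 2 / 2)) =
      ENNReal.ofReal (Real.exp (-b * r ^ 2 / 2) / b) := by
  have hderiv : ∀ x ∈ Set.Ioi r, HasDerivAt (fun x : ℝ => -(Real.exp (-b * x ^ 2 / 2) / b))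
      (x * Real.exp (-b * x ^ 2 / 2)) x := by
    intro x _
    have h1 : HasDerivAt (fun x : ℝ => -b * x ^ 2 / 2) (-b * x) x := by
      have := ((hasDerivAt_pow 2 x).const_mul (-b)).div_const 2
      refine this.congr_deriv ?_
      push_cast; ring
    have h2 := (h1.exp.div_const b).neg
    refine h2.congr_deriv ?_
    field_simp
  have hcont : ContinuousWithinAt (fun x : ℝ => -(Real.exp (-b * x ^ 2 / 2) / b)) (Set.Ici r) r := by
    apply Continuous.continuousWithinAt; fun_prop
  have hlim : Tendsto (fun x : ℝ => -(Real.exp (-b * x ^ 2 / 2) / b)) atTop (𝓝 0) := by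
    have h3 : Tendsto (fun x : ℝ => -b * x ^ 2 / 2) atTop atBot := by
      have : Tendsto (fun x : ℝ => (b / 2) * x ^ 2) atTop atTop :=
        (tendsto_pow_atTop two_ne_zero).const_mul_atTop (by positivity)
      refine (tendsto_neg_atTop_atBot.comp this).congr fun x => ?_
      simp only [Function.comp]; ring
    have := ((Real.tendsto_exp_atBot.comp h3).div_const b).neg
    simpa using this
  have hnn : ∀ x ∈ Set.Ioi r, 0 ≤ x * Real.exp (-b * x ^ 2 / 2) := fun x hx =>
    mul_nonneg (hr.trans (le_of_lt hx)) (Real.exp_nonneg _)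
  have hint := integrableOn_Ioi_deriv_of_nonneg hcont hderiv hnn hlim
  have hval := integral_Ioi_of_hasDerivAt_of_nonneg hcont hderiv hnn hlim
  rw [setLIntegral_congr Ioi_ae_eq_Ici.symm,
    ← ofReal_integral_eq_lintegral_ofReal hint
      ((ae_restrict_iff' measurableSet_Ioi).2 (Eventually.of_forall hnn)), hval]
  congr 1; ring

/-- Integrals of radial functions against the standard Gaussian measure on `ℂ`. -/
theorem lintegral_norm_stdComplexGaussian {f : ℝ → ℝ≥0∞} (hf : Measurable f) :
    ∫⁻ z, f ‖z‖ ∂stdComplexGaussian =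
      ∫⁻ x in Set.Ioi (0 : ℝ), ENNReal.ofReal (x * Real.exp (-x ^ 2 / 2)) * f x := by
  have hnorm : ∀ p : ℝ × ℝ, ‖(p.1 : ℂ) + p.2 * Complex.I‖ = Real.sqrt (p.1 ^ 2 + p.2 ^ 2) :=
    fun p => Complex.norm_add_mul_I p.1 p.2
  have h1 : ∫⁻ z, f ‖z‖ ∂stdComplexGaussian =
      ∫⁻ p, f (Real.sqrt (p.1 ^ 2 + p.2 ^ 2)) ∂((gaussianReal 0 1).prod (gaussianReal 0 1)) := by
    rw [stdComplexGaussian, stdGaussian_eq_map_pi_orthonormalBasis Complex.orthonormalBasisOneI,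
      lintegral_map (by fun_prop) (by fun_prop),
      ← (measurePreserving_piFinTwo (fun _ : Fin 2 => gaussianReal 0 1)).lintegral_comp
        (by fun_prop)]
    refine lintegral_congr fun x => ?_
    rw [← hnorm]
    simp [MeasurableEquiv.piFinTwo]
  have h2 : ∫⁻ p, f (Real.sqrt (p.1 ^ 2 + p.2 ^ 2)) ∂((gaussianReal 0 1).prod (gaussianReal 0 1)) =
      ∫⁻ p : ℝ × ℝ, gaussianPDF 0 1 p.1 * gaussianPDF 0 1 p.2 *
        f (Real.sqrt (p.1 ^ 2 + p.2 ^ 2)) := by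
    rw [gaussianReal_of_var_ne_zero 0 one_ne_zero, prod_withDensity
      (measurable_gaussianPDF 0 1) (measurable_gaussianPDF 0 1),
      lintegral_withDensity_eq_lintegral_mul _ (by fun_prop) (by fun_prop)]
    rfl
  have hpdf : ∀ p : ℝ × ℝ, gaussianPDF 0 1 p.1 * gaussianPDF 0 1 p.2 =
      ENNReal.ofReal ((2 * Real.pi)⁻¹ * Real.exp (-(p.1 ^ 2 + p.2 ^ 2) / 2)) := by
    intro p
    rw [gaussianPDF, gaussianPDF, ← ENNReal.ofReal_mul (gaussianPDFReal_nonneg 0 1 _),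
      gaussianPDFReal, gaussianPDFReal]
    congr 1
    have hs : (Real.sqrt (2 * Real.pi))⁻¹ * (Real.sqrt (2 * Real.pi))⁻¹ = (2 * Real.pi)⁻¹ := by
      rw [← mul_inv, Real.mul_self_sqrt (by positivity)]
    simp only [NNReal.coe_one, mul_one, sub_zero]
    rw [mul_mul_mul_comm, hs, ← Real.exp_add]
    congr 2; ring
  have hpol : ∀ p : ℝ × ℝ, 0 < p.1 →
      (polarCoord.symm p).1 ^ 2 + (polarCoord.symm p).2 ^ 2 = p.1 ^ 2 := by
    intro p _
    simp only [polarCoord_symm_apply]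
    linear_combination p.1 ^ 2 * Real.sin_sq_add_cos_sq p.2
  rw [h1, h2, ← lintegral_comp_polarCoord_symm]
  have h3 : ∫⁻ p in polarCoord.target, ENNReal.ofReal p.1 •
      (gaussianPDF 0 1 (polarCoord.symm p).1 * gaussianPDF 0 1 (polarCoord.symm p).2 *
        f (Real.sqrt ((polarCoord.symm p).1 ^ 2 + (polarCoord.symm p).2 ^ 2))) =
      ∫⁻ p in Set.Ioi (0 : ℝ) ×ˢ Set.Ioo (-Real.pi) Real.pi,
        (ENNReal.ofReal (p.1 * Real.exp (-p.1 ^ 2 / 2)) * f p.1) *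
          ENNReal.ofReal (2 * Real.pi)⁻¹ := by
    refine setLIntegral_congr_fun (by exact measurableSet_Ioi.prod measurableSet_Ioo) ?_
    rintro p ⟨hp, -⟩
    have hp : 0 < p.1 := hp
    simp only [hpdf, hpol p hp, Real.sqrt_sq hp.le, smul_eq_mul]
    rw [ENNReal.ofReal_mul (by positivity), ENNReal.ofReal_mul hp.le]
    ring
  rw [h3, Measure.volume_eq_prod, ← Measure.prod_restrict, lintegral_prod_mul
    (f := fun x => ENNReal.ofReal (x * Real.exp (-x ^ 2 / 2)) * f x)
    (g := fun _ => ENNReal.ofReal (2 * Real.pi)⁻¹) (by fun_prop) (by fun_prop)]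
  rw [lintegral_const, Measure.restrict_apply_univ, Real.volume_Ioo,
    ← ENNReal.ofReal_mul (by positivity)]
  have : (2 * Real.pi)⁻¹ * (Real.pi - -Real.pi) = 1 := by
    have := Real.pi_pos; field_simp; ring
  rw [this, ENNReal.ofReal_one, mul_one]

/-- Exponential quadratic moments of the standard complex Gaussian beyond a level. -/
theorem lintegral_exp_sq_stdComplexGaussian {c r : ℝ} (hc : 2 * c < 1) (hr : 0 ≤ r) :
    ∫⁻ z in {z : ℂ | r ≤ ‖z‖}, ENNReal.ofReal (Real.exp (c * ‖z‖ ^ 2)) ∂stdComplexGaussian =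
      ENNReal.ofReal (Real.exp (-(1 - 2 * c) * r ^ 2 / 2) / (1 - 2 * c)) := by
  have h0 := lintegral_norm_stdComplexGaussian
    (f := (Set.Ici r).indicator fun x => ENNReal.ofReal (Real.exp (c * x ^ 2)))
    ((by fun_prop : Measurable fun x : ℝ => ENNReal.ofReal (Real.exp (c * x ^ 2))).indicator
      measurableSet_Ici)
  rw [← lintegral_indicator (measurableSet_le measurable_const measurable_norm)]
  refine Eq.trans ?_ (h0.trans ?_)
  · rfl
  · rw [← lintegral_Ici_mul_exp_neg_sq (by linarith : 0 < 1 - 2 * c) hr]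
    have : ∀ x, ENNReal.ofReal (x * Real.exp (-x ^ 2 / 2)) *
        (Set.Ici r).indicator (fun x => ENNReal.ofReal (Real.exp (c * x ^ 2))) x =
        (Set.Ici r).indicator
          (fun x => ENNReal.ofReal (x * Real.exp (-(1 - 2 * c) * x ^ 2 / 2))) x := by
      intro x
      by_cases hx : x ∈ Set.Ici r
      · have hx0 : 0 ≤ x := hr.trans hx
        rw [Set.indicator_of_mem hx, Set.indicator_of_mem hx,
          ← ENNReal.ofReal_mul (by positivity), mul_assoc, ← Real.exp_add]
        congr 3; ring
      · simp [Set.indicator_of_notMem hx]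
    simp_rw [this]
    rw [setLIntegral_congr Ioi_ae_eq_Ici, setLIntegral_indicator measurableSet_Ici,
      Set.inter_eq_left.2 (Set.Ici_subset_Ici.2 hr)]

/-- The modulus of a standard complex Gaussian has the Rayleigh tail. -/
theorem stdComplexGaussian_norm_ge {r : ℝ} (hr : 0 ≤ r) :
    stdComplexGaussian {z : ℂ | r ≤ ‖z‖} = ENNReal.ofReal (Real.exp (-r ^ 2 / 2)) := by
  have := lintegral_exp_sq_stdComplexGaussian (c := 0) (by norm_num) hr
  simpa using this

/-- Multiplication by `a` has real adjoint multiplication by `conj a`. This moves a weight from the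
random variable to the argument of its characteristic function. -/
theorem inner_mul_left_conj (z a t : ℂ) : inner ℝ (z * a) t = inner ℝ z (t * conj a) := by
  simp only [Complex.inner, map_mul, Complex.mul_re, Complex.mul_im, Complex.conj_re,
    Complex.conj_im]
  ring

/-! ### Weighted sums of independent complex Gaussians -/

section GaussianSums

variable {Ω : Type*} [MeasurableSpace Ω] {P : Measure Ω}
  {G : ℕ → Ω → ℂ}

/-- The law of `G j` is rotation invariant, so a weight `a j` only enters through its modulus;
independence then adds the squared moduli in the exponent. -/
theorem charFun_sum_mul (hlaw : ∀ j, HasLaw (G j) stdComplexGaussian P)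
    (hindep : iIndepFun G P) (S : Finset ℕ) (a : ℕ → ℂ) (t : ℂ) :
    charFun (P.map fun ω => ∑ j ∈ S, G j ω * a j) t =
      Complex.exp (-((∑ j ∈ S, ‖a j‖ ^ 2 : ℝ) * (‖t‖ : ℂ) ^ 2) / 2) := by
  have hi : iIndepFun (fun j ω => G j ω * a j) P :=
    hindep.comp (fun j z => z * a j) (fun j => by fun_prop)
  have hm : ∀ j, AEMeasurable (G j) P := fun j => (hlaw j).aemeasurable
  rw [iIndepFun.charFun_map_fun_finsetSum_eq_prod (X := fun j ω => G j ω * a j)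
    (fun j _ => (hm j).mul_const _) (hi.restrict _), Finset.prod_apply]
  have h1 : ∀ j, charFun (P.map fun ω => G j ω * a j) t =
      Complex.exp (-((‖a j‖ ^ 2 : ℝ) * (‖t‖ : ℂ) ^ 2) / 2) := by
    intro j
    have h2 : charFun (P.map fun ω => G j ω * a j) t =
        charFun (P.map (G j)) (t * (starRingEnd ℂ) (a j)) := by
      rw [charFun_apply, charFun_apply, integral_map ((hm j).mul_const _) (by fun_prop),
        integral_map (hm j) (by fun_prop)]
      simp only [inner_mul_left_conj]
    rw [h2, (hlaw j).map_eq, stdComplexGaussian, charFun_stdGaussian]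
    congr 1
    rw [norm_mul, RCLike.norm_conj]
    push_cast; ring
  simp only [h1, ← Complex.exp_sum]
  congr 1
  push_cast
  rw [Finset.sum_mul, ← Finset.sum_neg_distrib, Finset.sum_div]

theorem aemeasurable_sum_mul (hlaw : ∀ j, HasLaw (G j) stdComplexGaussian P) (S : Finset ℕ)
    (a : ℕ → ℂ) : AEMeasurable (fun ω => ∑ j ∈ S, G j ω * a j) P :=
  Finset.aemeasurable_fun_sum _ fun j _ => (hlaw j).aemeasurable.mul_const _

/-- A weighted sum of independent standard complex Gaussians is a multiple of one. -/
theorem map_sum_mul (hlaw : ∀ j, HasLaw (G j) stdComplexGaussian P)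
    (hindep : iIndepFun G P) (S : Finset ℕ) (a : ℕ → ℂ) :
    P.map (fun ω => ∑ j ∈ S, G j ω * a j) =
      stdComplexGaussian.map fun z => z * (Real.sqrt (∑ j ∈ S, ‖a j‖ ^ 2) : ℂ) := by
  have := hindep.isProbabilityMeasure
  have := Measure.isProbabilityMeasure_map (aemeasurable_sum_mul hlaw S a)
  have hp : IsProbabilityMeasure stdComplexGaussian := by
    unfold stdComplexGaussian; infer_instance
  have hm : AEMeasurable (fun z : ℂ => z * (Real.sqrt (∑ j ∈ S, ‖a j‖ ^ 2) : ℂ))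
    stdComplexGaussian := by fun_prop
  have := Measure.isProbabilityMeasure_map hm
  refine Measure.ext_of_charFun (funext fun t => ?_)
  rw [charFun_sum_mul hlaw hindep, charFun_apply, integral_map hm (by fun_prop)]
  simp only [inner_mul_left_conj]
  rw [← charFun_apply, stdComplexGaussian, charFun_stdGaussian]
  congr 1
  rw [norm_mul, RCLike.norm_conj, Complex.norm_real, Real.norm_of_nonneg (Real.sqrt_nonneg _)]
  rw [Complex.ofReal_mul, mul_pow, ← Complex.ofReal_pow (Real.sqrt _),
    Real.sq_sqrt (Finset.sum_nonneg fun j _ => by positivity)]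
  ring

theorem measure_norm_sum_mul_ge_eq (hlaw : ∀ j, HasLaw (G j) stdComplexGaussian P)
    (hindep : iIndepFun G P) (S : Finset ℕ) (a : ℕ → ℂ) {v r : ℝ} (hv : 0 < v)
    (ha : ∑ j ∈ S, ‖a j‖ ^ 2 = v) (hr : 0 ≤ r) :
    P {ω | r ≤ ‖∑ j ∈ S, G j ω * a j‖} = ENNReal.ofReal (Real.exp (-r ^ 2 / (2 * v))) := by
  have h1 : P {ω | r ≤ ‖∑ j ∈ S, G j ω * a j‖} =
      P.map (fun ω => ∑ j ∈ S, G j ω * a j) {z | r ≤ ‖z‖} := by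
    rw [Measure.map_apply_of_aemeasurable (aemeasurable_sum_mul hlaw S a)
      (measurableSet_le measurable_const measurable_norm)]
    rfl
  rw [h1, map_sum_mul hlaw hindep, Measure.map_apply (by fun_prop)
    (measurableSet_le measurable_const measurable_norm), ha]
  have hs : 0 < Real.sqrt v := Real.sqrt_pos.2 hv
  have h2 : (fun z : ℂ => z * (Real.sqrt v : ℂ)) ⁻¹' {z | r ≤ ‖z‖} =
      {z | r / Real.sqrt v ≤ ‖z‖} := by
    ext z
    simp only [Set.mem_preimage, Set.mem_ofPred_eq, norm_mul, Complex.norm_real,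
      Real.norm_of_nonneg hs.le, div_le_iff₀ hs]
  rw [h2, stdComplexGaussian_norm_ge (by positivity), div_pow, Real.sq_sqrt hv.le]
  congr 2; field_simp

theorem measure_norm_sum_mul_ge_le (hlaw : ∀ j, HasLaw (G j) stdComplexGaussian P)
    (hindep : iIndepFun G P) (S : Finset ℕ) (a : ℕ → ℂ) {v r : ℝ}
    (ha : ∑ j ∈ S, ‖a j‖ ^ 2 ≤ v) (hr : 0 ≤ r) :
    P {ω | r ≤ ‖∑ j ∈ S, G j ω * a j‖} ≤ ENNReal.ofReal (Real.exp (-r ^ 2 / (2 * v))) := by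
  have := hindep.isProbabilityMeasure
  have hnn : 0 ≤ ∑ j ∈ S, ‖a j‖ ^ 2 := Finset.sum_nonneg fun j _ => by positivity
  -- With zero variance the sum vanishes: the event is empty for `r > 0`, and for `r = 0` the bound
  -- is `1`, whatever `v` is.
  rcases hnn.eq_or_lt with h0 | h0
  · have hz : ∀ j ∈ S, a j = 0 := by
      intro j hj
      have := (Finset.sum_eq_zero_iff_of_nonneg (fun j _ => by positivity)).1 h0.symm j hj
      simpa using this
    have hzero : ∀ ω, ∑ j ∈ S, G j ω * a j = 0 := fun ω =>
      Finset.sum_eq_zero fun j hj => by rw [hz j hj, mul_zero]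
    simp only [hzero, norm_zero]
    rcases hr.eq_or_lt with rfl | hr
    · simp
    · simp [hr.not_ge]
  · rw [measure_norm_sum_mul_ge_eq hlaw hindep S a h0 rfl hr]
    refine ENNReal.ofReal_le_ofReal (Real.exp_le_exp.2 ?_)
    rw [neg_div, neg_div, neg_le_neg_iff]
    gcongr

/-- Orthogonal weighted sums of independent complex Gaussians are independent. -/
theorem indepFun_sum_mul (hlaw : ∀ j, HasLaw (G j) stdComplexGaussian P)
    (hindep : iIndepFun G P) (S : Finset ℕ) (a b : ℕ → ℂ)
    (hab : ∑ j ∈ S, conj (a j) * b j = 0) :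
    IndepFun (fun ω => ∑ j ∈ S, G j ω * a j) (fun ω => ∑ j ∈ S, G j ω * b j) P := by
  have := hindep.isProbabilityMeasure
  have hma := aemeasurable_sum_mul hlaw S a
  have hmb := aemeasurable_sum_mul hlaw S b
  rw [indepFun_iff_charFun_prod hma hmb]
  intro t
  obtain ⟨t, u⟩ := t
  rw [charFun_sum_mul hlaw hindep, charFun_sum_mul hlaw hindep]
  -- The joint characteristic function at `(t, u)` is that of one weighted sum, taken at `1`;
  -- orthogonality of the weights then kills the cross term in its variance (`h3`), so it factors.
  have h1 : charFun (P.map fun ω => WithLp.toLp 2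
      (∑ j ∈ S, G j ω * a j, ∑ j ∈ S, G j ω * b j)) (WithLp.toLp 2 (t, u)) =
      charFun (P.map fun ω => ∑ j ∈ S, G j ω * (a j * conj t + b j * conj u)) 1 := by
    rw [charFun_apply, charFun_apply, integral_map (by fun_prop) (by fun_prop),
      integral_map (aemeasurable_sum_mul hlaw S _) (by fun_prop)]
    refine integral_congr_ae (Eventually.of_forall fun ω => ?_)
    simp only [WithLp.prod_inner_apply]
    congr 3
    have h2 : ∑ j ∈ S, G j ω * (a j * conj t + b j * conj u) =
        (∑ j ∈ S, G j ω * a j) * conj t + (∑ j ∈ S, G j ω * b j) * conj u := by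
      rw [Finset.sum_mul, Finset.sum_mul, ← Finset.sum_add_distrib]
      exact Finset.sum_congr rfl fun j _ => by ring
    rw [h2, inner_add_left, inner_mul_left_conj, inner_mul_left_conj]
    simp
  rw [h1, charFun_sum_mul hlaw hindep, ← Complex.exp_add]
  congr 1
  have h3 : ∑ j ∈ S, ‖a j * conj t + b j * conj u‖ ^ 2 =
      (∑ j ∈ S, ‖a j‖ ^ 2) * ‖t‖ ^ 2 + (∑ j ∈ S, ‖b j‖ ^ 2) * ‖u‖ ^ 2 := by
    have h4 : ∀ j, ‖a j * conj t + b j * conj u‖ ^ 2 =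
        ‖a j‖ ^ 2 * ‖t‖ ^ 2 + ‖b j‖ ^ 2 * ‖u‖ ^ 2 + 2 * ((conj (a j) * b j) * (t * conj u)).re := by
      intro j
      simp only [Complex.sq_norm, Complex.normSq_apply, Complex.add_re, Complex.add_im,
        Complex.mul_re, Complex.mul_im, Complex.conj_re, Complex.conj_im]
      ring
    simp only [h4, Finset.sum_add_distrib, ← Finset.mul_sum, ← Finset.sum_mul]
    rw [← Complex.re_sum, ← Finset.sum_mul, hab]
    simp
  simp only [norm_one, h3]
  push_cast
  ring

/-- Decorrelation: two weighted sums of unimodular weights whose normalised covariance is at most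
`ρ` exceed a high level simultaneously with nearly the probability of independent events. -/
theorem measure_norm_sum_mul_ge_and_le (hlaw : ∀ j, HasLaw (G j) stdComplexGaussian P)
    (hindep : iIndepFun G P) (S : Finset ℕ) (hS : S.Nonempty) (a b : ℕ → ℂ)
    (ha : ∀ j ∈ S, ‖a j‖ = 1) (hb : ∀ j ∈ S, ‖b j‖ = 1) {ρ r : ℝ}
    (hab : ‖∑ j ∈ S, conj (a j) * b j‖ ≤ ρ * S.card) (hρ : 2 * ρ < 1) (hr : 0 ≤ r) :
    P {ω | r * Real.sqrt S.card ≤ ‖∑ j ∈ S, G j ω * a j‖ ∧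
        r * Real.sqrt S.card ≤ ‖∑ j ∈ S, G j ω * b j‖} ≤
      ENNReal.ofReal (Real.exp (-r ^ 2) * (Real.exp (ρ * r ^ 2) / (1 - 2 * ρ))) := by
  have := hindep.isProbabilityMeasure
  have hN : (0 : ℝ) < S.card := by exact_mod_cast hS.card_pos
  set N : ℝ := (S.card : ℝ) with hNdef
  have hNc : (N : ℂ) ≠ 0 := by exact_mod_cast hN.ne'
  -- Regress the second sum on the first: with `c` the normalised covariance, `Z` has weights
  -- orthogonal to those of `X`, hence is independent of it, and the second sum is `Z + c X`.
  set c : ℂ := (∑ j ∈ S, conj (a j) * b j) / N with hc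
  have hcρ : ‖c‖ ≤ ρ := by
    rw [hc, norm_div, Complex.norm_real, Real.norm_of_nonneg hN.le, div_le_iff₀ hN]
    exact hab
  have hρ0 : 0 ≤ ρ := (norm_nonneg c).trans hcρ
  set X : Ω → ℂ := fun ω => ∑ j ∈ S, G j ω * a j with hX
  set Z : Ω → ℂ := fun ω => ∑ j ∈ S, G j ω * (b j - c * a j) with hZ
  have hsumc : ∑ j ∈ S, conj (a j) * b j = c * N := by
    rw [hc, div_mul_cancel₀ _ hNc]
  have haa : ∀ j ∈ S, conj (a j) * a j = 1 := fun j hj => by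
    rw [Complex.conj_mul', ha j hj]; simp
  have hsa : ∑ j ∈ S, conj (a j) * a j = N := by
    rw [Finset.sum_congr rfl haa]; simp [hNdef]
  have hYZ : ∀ ω, ∑ j ∈ S, G j ω * b j = Z ω + c * X ω := by
    intro ω
    simp only [hZ, hX]
    rw [Finset.mul_sum, ← Finset.sum_add_distrib]
    exact Finset.sum_congr rfl fun j _ => by ring
  have hXm : AEMeasurable X P := aemeasurable_sum_mul hlaw S a
  have hZm : AEMeasurable Z P := aemeasurable_sum_mul hlaw S fun j => b j - c * a j
  have hind : IndepFun X Z P := by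
    refine indepFun_sum_mul hlaw hindep S a _ ?_
    have : ∑ j ∈ S, conj (a j) * (b j - c * a j) =
        ∑ j ∈ S, conj (a j) * b j - c * ∑ j ∈ S, conj (a j) * a j := by
      rw [Finset.mul_sum, ← Finset.sum_sub_distrib]
      exact Finset.sum_congr rfl fun j _ => by ring
    rw [this, hsumc, hsa, sub_self]
  have hvar : ∑ j ∈ S, ‖b j - c * a j‖ ^ 2 ≤ N := by
    have h4 : ∀ j ∈ S, ‖b j - c * a j‖ ^ 2 =
        1 + ‖c‖ ^ 2 - 2 * ((conj (a j) * b j) * conj c).re := by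
      intro j hj
      have e1 : ‖b j - c * a j‖ ^ 2 = ‖b j‖ ^ 2 + ‖c‖ ^ 2 * ‖a j‖ ^ 2 -
          2 * ((conj (a j) * b j) * conj c).re := by
        simp only [Complex.sq_norm, Complex.normSq_apply, Complex.sub_re, Complex.sub_im,
          Complex.mul_re, Complex.mul_im, Complex.conj_re, Complex.conj_im]
        ring
      rw [e1, ha j hj, hb j hj]; ring
    rw [Finset.sum_congr rfl h4, Finset.sum_sub_distrib, ← Finset.mul_sum, ← Complex.re_sum,
      ← Finset.sum_mul, hsumc, Finset.sum_const, nsmul_eq_mul, ← hNdef]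
    have : (c * N * conj c).re = N * ‖c‖ ^ 2 := by
      simp only [Complex.sq_norm, Complex.normSq_apply, Complex.mul_re, Complex.mul_im,
        Complex.conj_re, Complex.conj_im, Complex.ofReal_re, Complex.ofReal_im]
      ring
    rw [this]
    nlinarith [sq_nonneg ‖c‖]
  set A : Set (ℂ × ℂ) := {p | r * Real.sqrt N ≤ ‖p.1‖ ∧ r * Real.sqrt N - ρ * ‖p.1‖ ≤ ‖p.2‖}
    with hA
  have hAm : MeasurableSet A := by
    rw [hA, Set.ofPred_and]
    exact (measurableSet_le (by fun_prop) (by fun_prop)).inter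
      (measurableSet_le (by fun_prop) (by fun_prop))
  have hle : P {ω | r * Real.sqrt N ≤ ‖X ω‖ ∧ r * Real.sqrt N ≤ ‖∑ j ∈ S, G j ω * b j‖} ≤
      (P.map fun ω => (X ω, Z ω)) A := by
    rw [Measure.map_apply_of_aemeasurable (hXm.prodMk hZm) hAm]
    refine measure_mono fun ω hω => ⟨hω.1, ?_⟩
    have h5 := hω.2
    rw [hYZ] at h5
    have h6 := norm_add_le (Z ω) (c * X ω)
    rw [norm_mul] at h6
    have h7 := mul_le_mul_of_nonneg_right hcρ (norm_nonneg (X ω))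
    change r * Real.sqrt N - ρ * ‖X ω‖ ≤ ‖Z ω‖
    linarith
  refine hle.trans ?_
  have := Measure.isProbabilityMeasure_map hXm
  have := Measure.isProbabilityMeasure_map hZm
  rw [(indepFun_iff_map_prod_eq_prod_map_map hXm hZm).1 hind, Measure.prod_apply hAm]
  have hsq : Real.sqrt N ^ 2 = N := Real.sq_sqrt hN.le
  have hsN : 0 < Real.sqrt N := Real.sqrt_pos.2 hN
  -- Given `|X| = y√N` with `y ≥ r`, the tail of `Z` is at most `exp(-(r - ρy)²/2) ≤ exp(-r²/2 +
  -- ρry) ≤ exp(-r²/2 + ρy²)`. If `ρy ≥ r` the trivial bound `1` suffices, as then `ρy² ≥ r²`. The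
  -- weight `exp(ρy²)` is integrable against the Rayleigh law exactly because `2ρ < 1`.
  have hbound : ∀ x : ℂ, P.map Z (Prod.mk x ⁻¹' A) ≤
      {z : ℂ | r * Real.sqrt N ≤ ‖z‖}.indicator (fun z => ENNReal.ofReal (Real.exp (-r ^ 2 / 2)) *
        ENNReal.ofReal (Real.exp (ρ * (‖z‖ / Real.sqrt N) ^ 2))) x := by
    intro x
    by_cases hx : r * Real.sqrt N ≤ ‖x‖
    · rw [Set.indicator_of_mem (by exact hx), ← ENNReal.ofReal_mul (by positivity), ← Real.exp_add]
      set y := ‖x‖ / Real.sqrt N with hy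
      have hxy : ‖x‖ = y * Real.sqrt N := by rw [hy, div_mul_cancel₀ _ hsN.ne']
      have hry : r ≤ y := by rw [hy, le_div_iff₀ hsN]; exact hx
      have hy0 : 0 ≤ y := hr.trans hry
      have hry2 : r * y ≤ y ^ 2 := by nlinarith
      rcases le_total (ρ * y) r with h | h
      · have h8 : Prod.mk x ⁻¹' A ⊆ {z | (r - ρ * y) * Real.sqrt N ≤ ‖z‖} := by
          intro z hz
          have := hz.2
          simp only [Set.mem_ofPred_eq]
          rw [hxy] at this
          linarith
        refine (measure_mono h8).trans ?_
        rw [Measure.map_apply_of_aemeasurable hZm (measurableSet_le measurable_const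
          measurable_norm)]
        refine (measure_norm_sum_mul_ge_le hlaw hindep S _ hvar
          (mul_nonneg (sub_nonneg.2 h) hsN.le)).trans ?_
        refine ENNReal.ofReal_le_ofReal (Real.exp_le_exp.2 ?_)
        rw [mul_pow, hsq]
        have : -((r - ρ * y) ^ 2 * N) / (2 * N) = -(r - ρ * y) ^ 2 / 2 := by field_simp
        rw [this]
        nlinarith [sq_nonneg (ρ * y), mul_le_mul_of_nonneg_left hry2 hρ0]
      · refine prob_le_one.trans ?_
        rw [← ENNReal.ofReal_one]
        refine ENNReal.ofReal_le_ofReal (Real.one_le_exp ?_)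
        nlinarith [mul_le_mul_of_nonneg_left hry2 hρ0, mul_le_mul_of_nonneg_left h hr]
    · have : Prod.mk x ⁻¹' A = ∅ := by
        ext z; simp [hA, hx]
      simp [this]
  refine (lintegral_mono hbound).trans ?_
  have hms : MeasurableSet {z : ℂ | r * Real.sqrt N ≤ ‖z‖} :=
    measurableSet_le measurable_const measurable_norm
  rw [map_sum_mul hlaw hindep, lintegral_map ((by fun_prop : Measurable _).indicator hms)
    (by fun_prop)]
  have hsum : ∑ j ∈ S, ‖a j‖ ^ 2 = N := by
    rw [Finset.sum_congr rfl fun j hj => by rw [ha j hj, one_pow]]; simp [hNdef]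
  rw [hsum]
  have hre : ∀ z : ℂ, {z : ℂ | r * Real.sqrt N ≤ ‖z‖}.indicator
      (fun z => ENNReal.ofReal (Real.exp (-r ^ 2 / 2)) *
        ENNReal.ofReal (Real.exp (ρ * (‖z‖ / Real.sqrt N) ^ 2))) (z * (Real.sqrt N : ℂ)) =
      {z : ℂ | r ≤ ‖z‖}.indicator (fun z => ENNReal.ofReal (Real.exp (-r ^ 2 / 2)) *
        ENNReal.ofReal (Real.exp (ρ * ‖z‖ ^ 2))) z := by
    intro z
    simp only [Set.indicator, Set.mem_ofPred_eq, norm_mul, Complex.norm_real,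
      Real.norm_of_nonneg hsN.le, mul_le_mul_iff_left₀ hsN, mul_div_cancel_right₀ _ hsN.ne']
  simp only [hre]
  rw [lintegral_indicator (measurableSet_le measurable_const measurable_norm),
    lintegral_const_mul _ (by fun_prop), lintegral_exp_sq_stdComplexGaussian hρ hr,
    ← ENNReal.ofReal_mul (by positivity), ← mul_div_assoc, ← Real.exp_add, ← mul_div_assoc,
    ← Real.exp_add]
  refine le_of_eq ?_
  congr 3; ring

end GaussianSums

/-! ### Energy method for Hausdorff measure -/

/-- Thickening by a small `δ` adds at most `2δ` to the diameter, and `d ↦ d ^ s` is continuous. Open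
sets are needed for compactness, and a positive finite `r` for dividing by `r ^ s`. The supremum
over `t.Nonempty` is the form of the cost in the definition of `μH[s]`. -/
theorem exists_isOpen_edist_le_rpow {s : ℝ} (hs : 0 < s) (t : Set ℝ) (ht : Metric.ediam t ≤ 1)
    {ε : ℝ≥0∞} (hε : ε ≠ 0) :
    ∃ U : Set ℝ, IsOpen U ∧ t ⊆ U ∧ ∃ r : ℝ≥0∞, r ≠ 0 ∧ r ≠ ∞ ∧
      (∀ x ∈ U, ∀ y ∈ U, edist x y ≤ r) ∧
      r ^ s ≤ (⨆ _ : t.Nonempty, Metric.ediam t ^ s) + ε := by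
  have hcont : ∀ d : ℝ≥0∞, ∃ δ : ℝ, 0 < δ ∧ (d + 2 * ENNReal.ofReal δ) ^ s ≤ d ^ s + ε := by
    intro d
    by_cases hd : d ^ s = ∞
    · exact ⟨1, one_pos, by simp [hd]⟩
    have h1 : Tendsto (fun δ : ℝ => (d + 2 * ENNReal.ofReal δ) ^ s) (𝓝[>] 0) (𝓝 (d ^ s)) := by
      have : Continuous fun δ : ℝ => (d + 2 * ENNReal.ofReal δ) ^ s := by
        refine (ENNReal.continuous_rpow_const).comp (continuous_const.add ?_)
        exact (ENNReal.continuous_const_mul (by simp)).comp ENNReal.continuous_ofReal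
      have h2 := (this.tendsto 0).mono_left (nhdsWithin_le_nhds (s := Set.Ioi 0))
      simpa using h2
    have h3 : d ^ s < d ^ s + ε := ENNReal.lt_add_right hd hε
    obtain ⟨δ, hδ, hδ0⟩ := ((h1.eventually_lt_const h3).and self_mem_nhdsWithin).exists
    exact ⟨δ, hδ0, hδ.le⟩
  rcases t.eq_empty_or_nonempty with rfl | hne
  · obtain ⟨δ, hδ, h⟩ := hcont 0
    refine ⟨∅, isOpen_empty, subset_rfl, 2 * ENNReal.ofReal δ, by simp [hδ],
      ENNReal.mul_ne_top (by simp) ENNReal.ofReal_ne_top, by simp, ?_⟩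
    simpa [hs] using h
  · obtain ⟨δ, hδ, h⟩ := hcont (Metric.ediam t)
    refine ⟨Metric.thickening δ t, Metric.isOpen_thickening, Metric.self_subset_thickening hδ t,
      Metric.ediam t + 2 * ENNReal.ofReal δ, by simp [hδ], ?_, ?_, ?_⟩
    · exact ENNReal.add_ne_top.2 ⟨(ht.trans_lt ENNReal.one_lt_top).ne,
        ENNReal.mul_ne_top (by simp) ENNReal.ofReal_ne_top⟩
    · intro x hx y hy
      have h1 := Metric.ediam_thickening_le (s := t) (Real.toNNReal δ)
      rw [Real.coe_toNNReal δ hδ.le] at h1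
      exact (Metric.edist_le_ediam_of_mem hx hy).trans h1
    · simpa [hne] using h

/-- A set covered by countably many sets of small Hausdorff content carries little mass of a
density of finite energy. -/
theorem lintegral_le_of_energy_of_cover {s : ℝ} (h : ℝ → ℝ≥0∞) (hh : Measurable h)
    {U : ℕ → Set ℝ} (hU : ∀ n, IsOpen (U n)) {r : ℕ → ℝ≥0∞} (hr0 : ∀ n, r n ≠ 0)
    (hr : ∀ n, r n ≠ ∞) (hUr : ∀ n, ∀ x ∈ U n, ∀ y ∈ U n, edist x y ≤ r n) (hs : 0 < s)
    {A : ℝ≥0∞} (hA0 : A ≠ 0) (hA : A ≠ ∞) :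
    ∫⁻ x in ⋃ n, U n, h x ≤ A * ∑' n, r n ^ s +
      (∫⁻ x, ∫⁻ y, edist x y ^ (-s) * (h x * h y)) / A := by
  have hV : ∀ n, MeasurableSet (disjointed U n) :=
    fun n => MeasurableSet.disjointed (fun i => (hU i).measurableSet) n
  have hd : Pairwise (Function.onFun Disjoint (disjointed U)) := disjoint_disjointed U
  -- On a piece of diameter at most `r n` the kernel is at least `r n ^ (-s)`, so `m² ≤ r n ^ s *
  -- e`. Were `m` larger than both `A * r n ^ s` and `e / A`, multiplying would contradict this.
  -- Disjointness of the pieces lets the energies `e` add up to at most the total.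
  have hm : ∀ n, (∫⁻ x in disjointed U n, h x) ≤ A * r n ^ s +
      (∫⁻ x in disjointed U n, ∫⁻ y, edist x y ^ (-s) * (h x * h y)) / A := by
    intro n
    set m := ∫⁻ x in disjointed U n, h x with hmdef
    set e := ∫⁻ x in disjointed U n, ∫⁻ y, edist x y ^ (-s) * (h x * h y) with hedef
    have hsq : m * m ≤ r n ^ s * e := by
      calc m * m = ∫⁻ x in disjointed U n, ∫⁻ y in disjointed U n, h x * h y := by
            rw [hmdef, ← lintegral_mul_const _ hh]
            refine lintegral_congr fun x => ?_
            rw [lintegral_const_mul _ hh]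
        _ ≤ ∫⁻ x in disjointed U n, ∫⁻ y in disjointed U n,
              r n ^ s * (edist x y ^ (-s) * (h x * h y)) := by
            refine setLIntegral_mono' (hV n) fun x hx => setLIntegral_mono' (hV n) fun y hy => ?_
            rw [← mul_assoc]
            refine le_mul_of_one_le_left zero_le ?_
            have hle := hUr n x (disjointed_subset U n hx) y (disjointed_subset U n hy)
            have h0 : r n ^ s ≠ 0 := by simp [hr0 n, hr n]
            have ht : r n ^ s ≠ ∞ := ENNReal.rpow_ne_top_of_nonneg hs.le (hr n)
            rw [ENNReal.rpow_neg, ← div_eq_mul_inv]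
            rw [ENNReal.le_div_iff_mul_le (Or.inr h0) (Or.inr ht), one_mul]
            exact ENNReal.rpow_le_rpow hle hs.le
        _ = r n ^ s * ∫⁻ x in disjointed U n, ∫⁻ y in disjointed U n,
              edist x y ^ (-s) * (h x * h y) := by
            rw [← lintegral_const_mul']
            · refine lintegral_congr fun x => ?_
              rw [lintegral_const_mul' _ _ (ENNReal.rpow_ne_top_of_nonneg hs.le (hr n))]
            · exact ENNReal.rpow_ne_top_of_nonneg hs.le (hr n)
        _ ≤ r n ^ s * e := by
            rw [hedef]
            gcongr with x
            exact Measure.restrict_le_self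
    by_contra! hlt
    have h1 : A * r n ^ s < m := lt_of_le_of_lt le_self_add hlt
    have h2 : e / A < m := lt_of_le_of_lt le_add_self hlt
    have h3 : r n ^ s < m / A := by
      rw [ENNReal.lt_div_iff_mul_lt (Or.inl hA0) (Or.inl hA), mul_comm]; exact h1
    have h4 : e < m * A := by
      rwa [ENNReal.div_lt_iff (Or.inl hA0) (Or.inl hA)] at h2
    have h5 := ENNReal.mul_lt_mul h3 h4
    have h6 : m / A * (m * A) = m * m := by
      rw [mul_comm m A, ← mul_assoc, ENNReal.div_mul_cancel hA0 hA]
    rw [h6] at h5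
    exact absurd hsq h5.not_ge
  calc ∫⁻ x in ⋃ n, U n, h x = ∑' n, ∫⁻ x in disjointed U n, h x := by
        rw [← iUnion_disjointed, lintegral_iUnion hV hd]
    _ ≤ ∑' n, (A * r n ^ s +
          (∫⁻ x in disjointed U n, ∫⁻ y, edist x y ^ (-s) * (h x * h y)) / A) :=
        ENNReal.tsum_le_tsum hm
    _ = A * ∑' n, r n ^ s +
          (∑' n, ∫⁻ x in disjointed U n, ∫⁻ y, edist x y ^ (-s) * (h x * h y)) / A := by
        rw [ENNReal.tsum_add, ENNReal.tsum_mul_left]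
        simp only [div_eq_mul_inv, ENNReal.tsum_mul_right]
    _ ≤ _ := by
        rw [← lintegral_iUnion hV hd]
        gcongr
        exact Measure.restrict_le_self

/-- Energy method along a decreasing sequence of compact sets. -/
theorem hausdorffMeasure_iInter_ne_zero_of_energy {s : ℝ} (hs : 0 < s) {F : ℕ → Set ℝ}
    (hF : Antitone F) (hFc : ∀ K, IsCompact (F K)) {c C : ℝ≥0∞} (hc : c ≠ 0) (hC : C ≠ ∞)
    {h : ℕ → ℝ → ℝ≥0∞} (hh : ∀ K, Measurable (h K)) (hsupp : ∀ K, ∀ x ∉ F K, h K x = 0)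
    (hfreq : ∃ᶠ K in atTop, c ≤ ∫⁻ x, h K x ∧
      ∫⁻ x, ∫⁻ y, edist x y ^ (-s) * (h K x * h K y) ≤ C) :
    μH[s] (⋂ K, F K) ≠ 0 := by
  intro hzero
  wlog hct : c ≠ ∞ generalizing c
  · refine this (c := 1) one_ne_zero (hfreq.mono fun K hK => ⟨?_, hK.2⟩) ENNReal.one_ne_top
    rw [not_not.1 hct] at hK
    exact le_top.trans hK.1
  -- `A` makes the energy term smaller than `c / 2`; then `η`, half the cost allowed to the cover,
  -- makes the content term smaller than `c / 2`.
  obtain ⟨A, hA0, hA, hAC⟩ : ∃ A : ℝ≥0∞, A ≠ 0 ∧ A ≠ ∞ ∧ C / A < c / 2 := by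
    have hc2 : c / 2 ≠ 0 := by simp [hc]
    have hc2t : c / 2 ≠ ∞ := ENNReal.div_ne_top hct (by simp)
    refine ⟨(C + 1) / (c / 2), ?_, ?_, ?_⟩
    · simp [ENNReal.div_eq_zero_iff, hc2t]
    · exact ENNReal.div_ne_top (by simp [hC]) hc2
    · have h1 : (C + 1) / (c / 2) ≠ 0 := by simp [ENNReal.div_eq_zero_iff, hc2t]
      have h2 : (C + 1) / (c / 2) ≠ ∞ := ENNReal.div_ne_top (by simp [hC]) hc2
      rw [ENNReal.div_lt_iff (Or.inl h1) (Or.inl h2), ENNReal.mul_div_cancel hc2 hc2t]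
      exact ENNReal.lt_add_right hC one_ne_zero
  obtain ⟨η, hη0, hη⟩ : ∃ η : ℝ≥0∞, η ≠ 0 ∧ A * (η + η) < c / 2 := by
    have hx : c / 2 / 4 / A ≠ 0 := by
      simp [ENNReal.div_eq_zero_iff, hc, hA]
    refine ⟨c / 2 / 4 / A, hx, ?_⟩
    have hc2 : c / 2 ≠ 0 := by simp [hc]
    have hc2t : c / 2 ≠ ∞ := ENNReal.div_ne_top hct (by simp)
    rw [mul_add, ENNReal.mul_div_cancel hA0 hA, ← two_mul]
    have h8 : (2 : ℝ≥0∞) * (c / 2 / 4) = c / 2 / 2 := by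
      rw [show (4 : ℝ≥0∞) = 2 * 2 by norm_num, ENNReal.div_eq_inv_mul (b := 2 * 2),
        ENNReal.mul_inv (Or.inl (by simp)) (Or.inl (by simp)), ← mul_assoc, ← mul_assoc,
        ENNReal.mul_inv_cancel (by simp) (by simp), one_mul, ← ENNReal.div_eq_inv_mul]
    rw [h8]
    exact ENNReal.half_lt_self hc2 hc2t
  rw [Measure.hausdorffMeasure_apply] at hzero
  -- The scale `1` is arbitrary; it only keeps the diameters finite.
  have h1 := (iSup_le_iff.1 hzero.le) 1
  have h2 := (iSup_le_iff.1 h1) one_pos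
  have h3 := lt_of_le_of_lt h2 (pos_iff_ne_zero.2 hη0)
  simp only [iInf_lt_iff] at h3
  obtain ⟨t, hcov, hdiam, hsum⟩ := h3
  obtain ⟨ε, hε, hεsum⟩ := ENNReal.exists_pos_sum_of_countable' hη0 ℕ
  choose U hUo htU r hr0 hr hUr hrs using fun n =>
    exists_isOpen_edist_le_rpow hs (t n) (hdiam n) (hε n).ne'
  have hopen : IsOpen (⋃ n, U n) := isOpen_iUnion hUo
  -- By compactness an open cover of the intersection already covers some `F K0`, hence the support
  -- of every later `h K`. No limit measure has to be constructed.
  obtain ⟨K0, hK0⟩ : ∃ K, F K ⊆ ⋃ n, U n := by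
    refine exists_subset_nhds_of_isCompact' hF.directed_ge hFc (fun K => (hFc K).isClosed) ?_
    intro x hx
    exact hopen.mem_nhds ((hcov.trans (Set.iUnion_mono htU)) hx)
  obtain ⟨K, hK0K, hmass, henergy⟩ := (frequently_atTop.1 hfreq) K0
  have hsumr : ∑' n, r n ^ s ≤ η + η := by
    refine (ENNReal.tsum_le_tsum hrs).trans ?_
    rw [ENNReal.tsum_add]
    exact add_le_add hsum.le hεsum.le
  have hres : ∫⁻ x, h K x = ∫⁻ x in ⋃ n, U n, h K x := by
    rw [← lintegral_indicator hopen.measurableSet]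
    refine lintegral_congr fun x => ?_
    by_cases hx : x ∈ ⋃ n, U n
    · rw [Set.indicator_of_mem hx]
    · rw [Set.indicator_of_notMem hx, hsupp K x fun h => hx (hK0 (hF hK0K h))]
  have hfin := lintegral_le_of_energy_of_cover (h K) (hh K) hUo hr0 hr hUr hs hA0 hA
  rw [← hres] at hfin
  have hlast : c < c := by
    calc c ≤ A * ∑' n, r n ^ s + (∫⁻ x, ∫⁻ y, edist x y ^ (-s) * (h K x * h K y)) / A :=
          hmass.trans hfin
      _ ≤ A * (η + η) + C / A := by gcongr
      _ < c / 2 + c / 2 := ENNReal.add_lt_add hη hAC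
      _ = c := ENNReal.add_halves c
  exact lt_irrefl _ hlast

/-! ### Second moment method for limsup random fractals -/

section SecondMoment

variable {Ω : Type*} [MeasurableSpace Ω] {P : Measure Ω}

/-- Chebyshev's inequality for nonnegative extended variables. -/
theorem measure_lt_half_mean_le [IsProbabilityMeasure P] {M : Ω → ℝ≥0∞} (hM : Measurable M)
    {v w : ℝ≥0∞} (hv : v ≠ ∞) (hmean : ∫⁻ ω, M ω ∂P = v) (hsq : ∫⁻ ω, M ω * M ω ∂P ≤ w) :
    (v / 2) * (v / 2) * P {ω | M ω < v / 2} + v * v ≤ w := by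
  -- This is `(M - v)² ≥ (v/2)² 1_{M < v/2}`, expanded with all subtractions moved across so that it
  -- makes sense in `ℝ≥0∞`.
  have hpt : ∀ ω, {ω | M ω < v / 2}.indicator (fun _ => (v / 2) * (v / 2)) ω + 2 * v * M ω ≤
      M ω * M ω + v * v := by
    intro ω
    by_cases hω : M ω = ∞
    · simp [hω]
    lift v to NNReal using hv
    obtain ⟨m, hm⟩ : ∃ m : NNReal, (m : ℝ≥0∞) = M ω := ⟨_, ENNReal.coe_toNNReal hω⟩
    have h2 : (v : ℝ≥0∞) / 2 = ((v / 2 : NNReal) : ℝ≥0∞) := by simp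
    simp only [Set.indicator, Set.mem_ofPred_eq, ← hm, h2]
    by_cases hlt : m < v / 2
    · rw [if_pos (by exact_mod_cast hlt)]
      norm_cast
      rw [← NNReal.coe_le_coe]
      have hlt' : (m : ℝ) < v / 2 := by exact_mod_cast hlt
      push_cast
      nlinarith [m.coe_nonneg, v.coe_nonneg]
    · rw [if_neg (by exact_mod_cast hlt)]
      norm_cast
      rw [← NNReal.coe_le_coe]
      push_cast
      nlinarith [sq_nonneg ((m : ℝ) - v)]
  have hint := lintegral_mono (μ := P) hpt
  rw [lintegral_add_right _ (by fun_prop), lintegral_add_right _ (by fun_prop),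
    lintegral_const_mul _ hM, hmean, lintegral_indicator (measurableSet_lt hM measurable_const),
    setLIntegral_const, lintegral_const, measure_univ, mul_one] at hint
  have hvv : v * v ≠ ∞ := ENNReal.mul_ne_top hv hv
  have h3 : (v / 2) * (v / 2) * P {ω | M ω < v / 2} + v * v + v * v ≤ w + v * v := by
    calc _ = (v / 2) * (v / 2) * P {ω | M ω < v / 2} + 2 * v * v := by ring
      _ ≤ _ := hint.trans (by gcongr)
  exact (ENNReal.add_le_add_iff_right hvv).1 h3

/-- If events have probability at most `δ`, then so has the event that they eventually all hold. -/
theorem measure_eventually_le_of_forall {B : ℕ → Set Ω} {δ : ℝ≥0∞} (hB : ∀ K, P (B K) ≤ δ) :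
    P {ω | ∀ᶠ K in atTop, ω ∈ B K} ≤ δ := by
  have h1 : {ω | ∀ᶠ K in atTop, ω ∈ B K} = ⋃ n, ⋂ K ≥ n, B K := by
    ext ω; simp [eventually_atTop]
  have hmono : Monotone fun n => ⋂ K ≥ n, B K := fun a b hab =>
    Set.biInter_subset_biInter_left fun K hK => le_trans hab hK
  rw [h1, hmono.measure_iUnion]
  exact iSup_le fun n => (measure_mono (Set.biInter_subset_of_mem (le_refl n))).trans (hB n)

variable (P) in
/-- The second-moment ratio `P(A ∩ B) / p²` of two events of probability `p`. -/
noncomputable def pairRatio (p : ℝ≥0∞) (A B : Set Ω) : ℝ≥0∞ := P (A ∩ B) / (p * p)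

open Classical in
/-- The density `∏ 1_{E_k} / p_k` on the set `J`, over `k ∈ T`. -/
noncomputable def productDensity (E : ℕ → ℝ → Set Ω) (p : ℕ → ℝ≥0∞) (J : Set ℝ) (T : Finset ℕ)
    (ω : Ω) (x : ℝ) : ℝ≥0∞ :=
  J.indicator (fun x => ∏ k ∈ T, (if ω ∈ E k x then (p k)⁻¹ else 0)) x

variable {E : ℕ → ℝ → Set Ω} {p : ℕ → ℝ≥0∞} {J : Set ℝ}

theorem measurable_productDensity (hE : ∀ k, MeasurableSet {q : Ω × ℝ | q.1 ∈ E k q.2})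
    (hJ : MeasurableSet J) (T : Finset ℕ) :
    Measurable (Function.uncurry (productDensity E p J T)) := by
  classical
  have h1 : Function.uncurry (productDensity E p J T) =
      (Prod.snd ⁻¹' J : Set (Ω × ℝ)).indicator
        (fun q => ∏ k ∈ T, (if q.1 ∈ E k q.2 then (p k)⁻¹ else 0)) := by
    ext q
    simp [Function.uncurry, productDensity, Set.indicator]
  rw [h1]
  refine Measurable.indicator ?_ (measurable_snd hJ)
  exact Finset.measurable_fun_prod _ fun k _ =>
    Measurable.ite (hE k) measurable_const measurable_const

theorem lintegral_productDensity_mul (hE : ∀ k, MeasurableSet {q : Ω × ℝ | q.1 ∈ E k q.2})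
    (hind : ∀ T : Finset ℕ, ∀ x y, P (⋂ k ∈ T, (E k x ∩ E k y)) = ∏ k ∈ T, P (E k x ∩ E k y))
    (T : Finset ℕ) {x y : ℝ} (hx : x ∈ J) (hy : y ∈ J) :
    ∫⁻ ω, productDensity E p J T ω x * productDensity E p J T ω y ∂P =
      ∏ k ∈ T, (P (E k x ∩ E k y) * ((p k)⁻¹ * (p k)⁻¹)) := by
  classical
  have hEm : ∀ k x, MeasurableSet (E k x) := fun k x =>
    (measurable_prodMk_right (y := x)) (hE k)
  have h1 : ∀ ω, productDensity E p J T ω x * productDensity E p J T ω y =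
      (⋂ k ∈ T, (E k x ∩ E k y)).indicator (fun _ => ∏ k ∈ T, ((p k)⁻¹ * (p k)⁻¹)) ω := by
    intro ω
    rw [productDensity, productDensity, Set.indicator_of_mem hx, Set.indicator_of_mem hy,
      ← Finset.prod_mul_distrib]
    by_cases hω : ω ∈ ⋂ k ∈ T, (E k x ∩ E k y)
    · rw [Set.indicator_of_mem hω]
      refine Finset.prod_congr rfl fun k hk => ?_
      have := Set.mem_iInter₂.1 hω k hk
      rw [if_pos this.1, if_pos this.2]
    · rw [Set.indicator_of_notMem hω]
      simp only [Set.mem_iInter, not_forall] at hω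
      obtain ⟨k, hk, hkω⟩ := hω
      refine Finset.prod_eq_zero hk ?_
      by_cases h : ω ∈ E k x
      · have : ω ∉ E k y := fun h' => hkω ⟨h, h'⟩
        simp [this]
      · simp [h]
  simp only [h1]
  rw [lintegral_indicator_const (Finset.measurableSet_biInter _ fun k _ =>
    (hEm k x).inter (hEm k y)), hind, ← Finset.prod_mul_distrib]
  exact Finset.prod_congr rfl fun k _ => mul_comm _ _

/-- The density only takes the values `0` and `∏ (p k)⁻¹`, so it equals `∏ p k` times its own
square. The first moment is thus the second moment at `y = x`. -/
theorem lintegral_productDensity (hE : ∀ k, MeasurableSet {q : Ω × ℝ | q.1 ∈ E k q.2})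
    (hind : ∀ T : Finset ℕ, ∀ x y, P (⋂ k ∈ T, (E k x ∩ E k y)) = ∏ k ∈ T, P (E k x ∩ E k y))
    (hp : ∀ k, ∀ x ∈ J, P (E k x) = p k) (hp0 : ∀ k, p k ≠ 0) (hp1 : ∀ k, p k ≠ ∞)
    (T : Finset ℕ) {x : ℝ} (hx : x ∈ J) :
    ∫⁻ ω, productDensity E p J T ω x ∂P = 1 := by
  classical
  have hEm : ∀ k x, MeasurableSet (E k x) := fun k x =>
    (measurable_prodMk_right (y := x)) (hE k)
  have h1 : ∀ ω, productDensity E p J T ω x =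
      (∏ k ∈ T, p k) * (productDensity E p J T ω x * productDensity E p J T ω x) := by
    intro ω
    rw [productDensity, Set.indicator_of_mem hx, ← Finset.prod_mul_distrib,
      ← Finset.prod_mul_distrib]
    refine Finset.prod_congr rfl fun k _ => ?_
    split_ifs
    · rw [← mul_assoc, ENNReal.mul_inv_cancel (hp0 k) (hp1 k), one_mul]
    · simp
  have hm : Measurable fun ω => productDensity E p J T ω x := by
    have : Measurable fun ω => productDensity E (p := p) J T ω x := by
      have h2 : (fun ω => productDensity E p J T ω x) =
          fun ω => ∏ k ∈ T, (if ω ∈ E k x then (p k)⁻¹ else 0) := by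
        ext ω; rw [productDensity, Set.indicator_of_mem hx]
      rw [h2]
      exact Finset.measurable_fun_prod _ fun k _ =>
        Measurable.ite (hEm k x) measurable_const measurable_const
    exact this
  rw [lintegral_congr h1, lintegral_const_mul _ (by fun_prop),
    lintegral_productDensity_mul hE hind T hx hx, ← Finset.prod_mul_distrib]
  refine Finset.prod_eq_one fun k _ => ?_
  rw [Set.inter_self, hp k x hx, ← mul_assoc, ← mul_assoc, mul_assoc (p k * p k),
    mul_mul_mul_comm, ENNReal.mul_inv_cancel (hp0 k) (hp1 k), one_mul]

/-- The second moment method for limsup random fractals: independent random closed sets `E_k`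
whose pair correlations are integrable against the Riesz kernel of order `s`, with second moments
close to those of independent points, have intersections `⋂_{k ≥ k₀} E_k` of positive
`s`-dimensional Hausdorff measure for some `k₀`. -/
theorem ae_exists_hausdorffMeasure_ne_zero [IsProbabilityMeasure P]
    (hE : ∀ k, MeasurableSet {q : Ω × ℝ | q.1 ∈ E k q.2})
    (hclosed : ∀ k ω, IsClosed {x | ω ∈ E k x}) (hJ : IsCompact J) (hJ0 : volume J ≠ 0)
    (hind : ∀ T : Finset ℕ, ∀ x y, P (⋂ k ∈ T, (E k x ∩ E k y)) = ∏ k ∈ T, P (E k x ∩ E k y))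
    (hp : ∀ k, ∀ x ∈ J, P (E k x) = p k) (hp0 : ∀ k, p k ≠ 0) (hp1 : ∀ k, p k ≠ ∞)
    {s : ℝ} (hs : 0 < s)
    (hmoment : ∀ δ : ℝ≥0∞, δ ≠ 0 → ∃ k₀, (∀ K, ∫⁻ x in J, ∫⁻ y in J,
      ∏ k ∈ Finset.Ico k₀ K, pairRatio P (p k) (E k x) (E k y) ≤
        volume J * volume J + δ) ∧
      ∃ C : ℝ≥0∞, C ≠ ∞ ∧ ∀ K, ∫⁻ x in J, ∫⁻ y in J, edist x y ^ (-s) *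
        ∏ k ∈ Finset.Ico k₀ K, pairRatio P (p k) (E k x) (E k y) ≤ C) :
    ∀ᵐ ω ∂P, ∃ k₀ : ℕ, μH[s] (J ∩ {x | ∀ k ≥ k₀, ω ∈ E k x}) ≠ 0 := by
  classical
  set v := volume J with hv
  have hvt : v ≠ ∞ := hJ.measure_lt_top.ne
  have hJm := hJ.measurableSet
  rw [ae_iff]
  refine le_antisymm (ENNReal.le_of_forall_pos_le_add fun ε hε _ => ?_) zero_le
  rw [zero_add]
  set ε' : ℝ≥0∞ := ε / 2 with hε'
  have hε'0 : ε' ≠ 0 := by simp [hε', hε.ne']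
  have hv2 : (v / 2) * (v / 2) ≠ 0 := by simp [hJ0]
  have hv2t : (v / 2) * (v / 2) ≠ ∞ :=
    ENNReal.mul_ne_top (ENNReal.div_ne_top hvt (by simp)) (ENNReal.div_ne_top hvt (by simp))
  -- With this excess over `v * v`, Chebyshev's inequality gives probability at most `ε'` to a mass
  -- below `v / 2`. As `k₀` depends on `ε`, the final `k₀` depends on `ω`.
  obtain ⟨k₀, hsecond, C, hC, henergy⟩ := hmoment ((v / 2) * (v / 2) * ε')
    (mul_ne_zero hv2 hε'0)
  set T : ℕ → Finset ℕ := fun K => Finset.Ico k₀ K with hT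
  set h : ℕ → Ω → ℝ → ℝ≥0∞ := fun K => productDensity E p J (T K) with hh
  have hhm : ∀ K, Measurable (Function.uncurry (h K)) := fun K =>
    measurable_productDensity hE hJm _
  set M : ℕ → Ω → ℝ≥0∞ := fun K ω => ∫⁻ x, h K ω x with hM
  have hMm : ∀ K, Measurable (M K) := fun K => (hhm K).lintegral_prod_right
  set I : ℕ → Ω → ℝ≥0∞ := fun K ω => ∫⁻ x, ∫⁻ y, edist x y ^ (-s) * (h K ω x * h K ω y) with hI
  have hker : ∀ K, Measurable fun q : (Ω × ℝ) × ℝ =>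
      edist q.1.2 q.2 ^ (-s) * (h K q.1.1 q.1.2 * h K q.1.1 q.2) := by
    intro K
    have h1 : Measurable fun q : (Ω × ℝ) × ℝ => edist q.1.2 q.2 := by fun_prop
    have h2 : Measurable fun q : (Ω × ℝ) × ℝ => h K q.1.1 q.1.2 := (hhm K).comp measurable_fst
    have h3 : Measurable fun q : (Ω × ℝ) × ℝ => h K q.1.1 q.2 :=
      (hhm K).comp ((measurable_fst.comp measurable_fst).prodMk measurable_snd)
    exact (h1.pow_const _).mul (h2.mul h3)
  have hpairm : ∀ K, Measurable fun q : (Ω × ℝ) × ℝ => h K q.1.1 q.1.2 * h K q.1.1 q.2 := by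
    intro K
    have h2 : Measurable fun q : (Ω × ℝ) × ℝ => h K q.1.1 q.1.2 := (hhm K).comp measurable_fst
    have h3 : Measurable fun q : (Ω × ℝ) × ℝ => h K q.1.1 q.2 :=
      (hhm K).comp ((measurable_fst.comp measurable_fst).prodMk measurable_snd)
    exact h2.mul h3
  have hIm : ∀ K, Measurable (I K) := fun K =>
    ((hker K).lintegral_prod_right').lintegral_prod_right'
  have hout : ∀ K ω x, x ∉ J → h K ω x = 0 := fun K ω x hx => by
    simp only [hh, productDensity, Set.indicator_of_notMem hx]
  have hmean : ∀ K, ∫⁻ ω, M K ω ∂P = v := by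
    intro K
    simp only [hM]
    rw [lintegral_lintegral_swap (hhm K).aemeasurable]
    have h1 : ∀ x, ∫⁻ ω, h K ω x ∂P = J.indicator 1 x := by
      intro x
      by_cases hx : x ∈ J
      · rw [Set.indicator_of_mem hx]
        exact lintegral_productDensity hE hind hp hp0 hp1 _ hx
      · simp [hout K _ x hx, hx]
    simp only [h1]
    rw [lintegral_indicator_one hJm]
  have hpair : ∀ K x y, ∫⁻ ω, h K ω x * h K ω y ∂P = J.indicator (fun x => J.indicator
      (fun y => ∏ k ∈ T K, pairRatio P (p k) (E k x) (E k y)) y) x := by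
    intro K x y
    by_cases hx : x ∈ J
    · by_cases hy : y ∈ J
      · rw [Set.indicator_of_mem hx, Set.indicator_of_mem hy]
        refine (lintegral_productDensity_mul hE hind _ hx hy).trans ?_
        refine Finset.prod_congr rfl fun k _ => ?_
        rw [pairRatio, div_eq_mul_inv, ENNReal.mul_inv (Or.inl (hp0 k)) (Or.inl (hp1 k))]
      · simp [hout K _ y hy, hx, hy]
    · simp [hout K _ x hx, hx]
  have hswap : ∀ K (κ : ℝ → ℝ → ℝ≥0∞), Measurable (Function.uncurry κ) →
      ∫⁻ ω, (∫⁻ x, ∫⁻ y, κ x y * (h K ω x * h K ω y)) ∂P =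
      ∫⁻ x in J, ∫⁻ y in J, κ x y * ∏ k ∈ T K, pairRatio P (p k) (E k x) (E k y) := by
    intro K κ hκ
    have hm3 : Measurable fun q : (Ω × ℝ) × ℝ => κ q.1.2 q.2 * (h K q.1.1 q.1.2 * h K q.1.1 q.2) :=
      (hκ.comp ((measurable_snd.comp measurable_fst).prodMk measurable_snd)).mul (hpairm K)
    rw [lintegral_lintegral_swap (hm3.lintegral_prod_right').aemeasurable,
      ← lintegral_indicator hJm]
    refine lintegral_congr fun x => ?_
    have hm2 : Measurable (Function.uncurry fun (ω : Ω) (y : ℝ) =>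
        κ x y * (h K ω x * h K ω y)) :=
      hm3.comp ((measurable_fst.prodMk measurable_const).prodMk measurable_snd)
    rw [lintegral_lintegral_swap hm2.aemeasurable]
    have hprod : ∀ y, Measurable fun ω => h K ω x * h K ω y := fun y =>
      (hpairm K).comp ((measurable_id.prodMk measurable_const).prodMk measurable_const)
    simp only [lintegral_const_mul _ (hprod _), hpair]
    by_cases hx : x ∈ J
    · rw [Set.indicator_of_mem hx, ← lintegral_indicator hJm]
      refine lintegral_congr fun y => ?_
      by_cases hy : y ∈ J <;> simp [hx, hy]
    · simp [hx]
  have hsq : ∀ K, ∫⁻ ω, M K ω * M K ω ∂P ≤ v * v + (v / 2) * (v / 2) * ε' := by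
    intro K
    have h1 : ∀ ω, M K ω * M K ω = ∫⁻ x, ∫⁻ y, 1 * (h K ω x * h K ω y) := by
      intro ω
      have hmω : Measurable (h K ω) := (hhm K).comp measurable_prodMk_left
      simp only [hM, one_mul]
      rw [← lintegral_mul_const _ hmω]
      refine lintegral_congr fun x => ?_
      rw [lintegral_const_mul _ hmω]
    simp only [h1]
    rw [hswap K (fun _ _ => 1) measurable_const]
    simpa only [one_mul] using hsecond K
  have hIle : ∀ K, ∫⁻ ω, I K ω ∂P ≤ C := by
    intro K
    simp only [hI]
    rw [hswap K (fun x y => edist x y ^ (-s)) (measurable_edist.pow_const _)]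
    exact henergy K
  have hB1 : ∀ K, P {ω | M K ω < v / 2} ≤ ε' := by
    intro K
    have h1 := measure_lt_half_mean_le (hMm K) hvt (hmean K) (hsq K)
    rw [add_comm (v * v), ENNReal.add_le_add_iff_right (ENNReal.mul_ne_top hvt hvt)] at h1
    exact (ENNReal.mul_le_mul_iff_right hv2 hv2t).1 h1
  set D : ℝ≥0∞ := (C + 1) / ε' with hD
  have hε't : ε' ≠ ∞ := ENNReal.div_ne_top ENNReal.coe_ne_top (by simp)
  have hDt : D ≠ ∞ := ENNReal.div_ne_top (by simp [hC]) hε'0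
  have hD0 : D ≠ 0 := by simp [hD, ENNReal.div_eq_zero_iff, hε't]
  have hB2 : ∀ K, P {ω | D ≤ I K ω} ≤ ε' := by
    intro K
    refine (meas_ge_le_lintegral_div (hIm K).aemeasurable hD0 hDt).trans ?_
    refine ENNReal.div_le_of_le_mul ?_
    rw [hD, ENNReal.mul_div_cancel hε'0 hε't]
    exact (hIle K).trans le_self_add
  have hB : ∀ K, P ({ω | M K ω < v / 2} ∪ {ω | D ≤ I K ω}) ≤ ε := by
    intro K
    refine (measure_union_le _ _).trans ((add_le_add (hB1 K) (hB2 K)).trans ?_)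
    rw [hε', ENNReal.add_halves]
  -- If the bad events (small mass or large energy) do not eventually all occur at `ω`, then mass
  -- and energy are controlled for infinitely many `K`, and the energy method makes this very `k₀`
  -- succeed.
  refine le_trans (measure_mono ?_) (measure_eventually_le_of_forall hB)
  intro ω hω
  simp only [Set.mem_ofPred_eq, not_exists, not_not] at hω ⊢
  by_contra hev
  have hfreq : ∃ᶠ K in atTop, v / 2 ≤ ∫⁻ x, h K ω x ∧
      ∫⁻ x, ∫⁻ y, edist x y ^ (-s) * (h K ω x * h K ω y) ≤ D := by
    refine (not_eventually.1 hev).mono fun K hK => ?_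
    simp only [Set.mem_union, Set.mem_ofPred_eq, not_or, not_lt, not_le] at hK
    exact ⟨hK.1, hK.2.le⟩
  set F : ℕ → Set ℝ := fun K => J ∩ {x | ∀ k ∈ T K, ω ∈ E k x} with hF
  have hFanti : Antitone F := fun a b hab x hx =>
    ⟨hx.1, fun k hk => hx.2 k (Finset.Ico_subset_Ico_right hab hk)⟩
  have hFc : ∀ K, IsCompact (F K) := by
    intro K
    refine hJ.inter_right ?_
    have : {x | ∀ k ∈ T K, ω ∈ E k x} = ⋂ k ∈ T K, {x | ω ∈ E k x} := by
      ext x; simp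
    rw [this]
    exact isClosed_biInter fun k _ => hclosed k ω
  have hsupp : ∀ K, ∀ x ∉ F K, h K ω x = 0 := by
    intro K x hx
    by_cases hxJ : x ∈ J
    · have : ∃ k ∈ T K, ω ∉ E k x := by
        by_contra! hcon
        exact hx ⟨hxJ, hcon⟩
      obtain ⟨k, hk, hkx⟩ := this
      simp only [hh, productDensity, Set.indicator_of_mem hxJ]
      exact Finset.prod_eq_zero hk (by simp [hkx])
    · exact hout K ω x hxJ
  have hne := hausdorffMeasure_iInter_ne_zero_of_energy hs hFanti hFc
    (c := v / 2) (by simp [hJ0]) hDt (fun K => (hhm K).comp measurable_prodMk_left) hsupp hfreq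
  apply hne
  rw [← nonpos_iff_eq_zero, ← hω k₀]
  refine measure_mono fun x hx => ?_
  rw [Set.mem_iInter] at hx
  exact ⟨(hx 0).1, fun k hk => (hx (k + 1)).2 k (Finset.mem_Ico.2 ⟨hk, Nat.lt_succ_self k⟩)⟩

end SecondMoment

/-! ### Riesz kernels and products of pair correlations -/

/-- The integral of the Riesz kernel of order `a` near the origin. -/
noncomputable def rieszIntegral (a τ : ℝ) : ℝ≥0∞ :=
  ∫⁻ t in Metric.ball (0 : ℝ) τ, edist t 0 ^ (-a)

theorem rieszIntegral_ne_top {a : ℝ} (ha : a < 1) (τ : ℝ) : rieszIntegral a τ ≠ ∞ := by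
  rcases le_or_gt τ 0 with hτ | hτ
  · simp [rieszIntegral, Metric.ball_eq_empty.2 hτ]
  have h1 : IntegrableOn (fun x : ℝ => x ^ (-a)) (Set.Ioo 0 τ) :=
    (intervalIntegral.integrableOn_Ioo_rpow_iff hτ).2 (by linarith)
  have h2 : Integrable (fun x : ℝ => (Set.Iio τ).indicator (fun x => x ^ (-a)) ‖x‖) := by
    rw [integrable_fun_norm_addHaar (volume : Measure ℝ)]
    simp only [Module.finrank_self, Nat.sub_self, pow_zero, one_smul]
    rw [IntegrableOn, integrable_indicator_iff measurableSet_Iio, IntegrableOn,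
      Measure.restrict_restrict measurableSet_Iio, Set.inter_comm, Set.Ioi_inter_Iio]
    exact h1
  have h3 := h2.hasFiniteIntegral
  rw [HasFiniteIntegral] at h3
  refine (lt_of_le_of_lt ?_ h3).ne
  rw [rieszIntegral, ← lintegral_indicator Metric.isOpen_ball.measurableSet]
  refine lintegral_mono_ae ?_
  have hae : ∀ᵐ t : ℝ, t ≠ 0 := by simp [ae_iff]
  filter_upwards [hae] with t ht
  by_cases h : t ∈ Metric.ball (0 : ℝ) τ
  · have h' : ‖t‖ ∈ Set.Iio τ := by simpa using h
    have htn : 0 < ‖t‖ := norm_pos_iff.2 ht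
    rw [Set.indicator_of_mem h, Set.indicator_of_mem h', Real.enorm_of_nonneg (by positivity),
      edist_zero_right, ← ofReal_norm, ENNReal.ofReal_rpow_of_pos htn]
  · rw [Set.indicator_of_notMem h]; exact zero_le

theorem tendsto_rieszIntegral {a : ℝ} (ha : a < 1) {τ : ℕ → ℝ} (hτ : Tendsto τ atTop (𝓝 0)) :
    Tendsto (fun k => rieszIntegral a (τ k)) atTop (𝓝 0) := by
  have h1 : ∀ᶠ k in atTop, rieszIntegral a (τ k) =
      ∫⁻ t in Metric.ball (0 : ℝ) (τ k), edist t 0 ^ (-a) ∂(volume.restrict (Metric.ball 0 1)) := by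
    filter_upwards [hτ.eventually_lt_const one_pos] with k hk
    rw [rieszIntegral, Measure.restrict_restrict Metric.isOpen_ball.measurableSet,
      Set.inter_eq_left.2 (Metric.ball_subset_ball hk.le)]
  rw [tendsto_congr' h1]
  refine tendsto_setLIntegral_zero (rieszIntegral_ne_top ha 1) ?_
  have h2 : Tendsto (fun k => volume (Metric.ball (0 : ℝ) (τ k))) atTop (𝓝 0) := by
    simp only [Real.volume_ball]
    have := ENNReal.tendsto_ofReal (hτ.const_mul 2)
    simpa using this
  exact tendsto_of_tendsto_of_tendsto_of_le_of_le tendsto_const_nhds h2 (fun _ => zero_le)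
    fun k => Measure.restrict_le_self _

theorem setLIntegral_ball_edist_rpow (a τ x : ℝ) :
    ∫⁻ y in Metric.ball x τ, edist x y ^ (-a) = rieszIntegral a τ := by
  rw [rieszIntegral, ← lintegral_indicator Metric.isOpen_ball.measurableSet,
    ← lintegral_indicator Metric.isOpen_ball.measurableSet,
    ← lintegral_sub_right_eq_self ((Metric.ball (0 : ℝ) τ).indicator _) x]
  refine lintegral_congr fun y => ?_
  have : edist x y = edist (y - x) 0 := by
    rw [edist_comm, edist_dist, edist_dist, dist_zero_right, Real.dist_eq, Real.norm_eq_abs]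
  simp only [Set.indicator, Metric.mem_ball, dist_zero_right, Real.norm_eq_abs, Real.dist_eq, this]

section PairProducts

variable {R : ℕ → ℝ → ℝ → ℝ≥0∞} {q : ℕ → ℝ≥0∞} {τ : ℕ → ℝ} {a : ℝ}

/-- Products of pair correlations: only the scales that do not separate `x` and `y` matter. -/
theorem prod_pair_le {x y : ℝ} (hτ : Antitone τ) (ha : 0 ≤ a)
    (hfar : ∀ k, τ k ≤ dist x y → R k x y ≤ ENNReal.ofReal (Real.exp ((1 / 2) ^ k)))
    (hnear : ∀ k, R k x y ≤ q k) (hq1 : ∀ k, 1 ≤ q k)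
    (hq : ∀ k, ∏ j ∈ Finset.range (k + 1), q j ≤ ENNReal.ofReal (τ k) ^ (-a)) (k₀ K : ℕ) :
    ∏ k ∈ Finset.Ico k₀ K, R k x y ≤ ENNReal.ofReal (Real.exp (2 * (1 / 2) ^ k₀)) *
      (1 + (Metric.ball x (τ k₀)).indicator (fun y => edist x y ^ (-a)) y) := by
  set B := (1 + (Metric.ball x (τ k₀)).indicator (fun y => edist x y ^ (-a)) y) with hB
  have hB1 : 1 ≤ B := le_self_add
  rcases le_total K k₀ with hK | hK
  · rw [Finset.Ico_eq_empty_of_le hK, Finset.prod_empty]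
    refine one_le_mul ?_ hB1
    rw [← ENNReal.ofReal_one]
    exact ENNReal.ofReal_le_ofReal (Real.one_le_exp (by positivity))
  -- The exponent is the partial sum `∑_{k₀ ≤ k < K} 2^(-k)`, kept exact so that the induction
  -- closes.
  have key : ∀ K, k₀ ≤ K → ∏ k ∈ Finset.Ico k₀ K, R k x y ≤
      ENNReal.ofReal (Real.exp (2 * (1 / 2) ^ k₀ - 2 * (1 / 2) ^ K)) * B := by
    intro K hK
    induction K, hK using Nat.le_induction with
    | base => simpa using hB1
    | succ K hK ih =>
      rcases le_or_gt (τ K) (dist x y) with h | h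
      · rw [Finset.prod_Ico_succ_top hK]
        calc _ ≤ ENNReal.ofReal (Real.exp (2 * (1 / 2) ^ k₀ - 2 * (1 / 2) ^ K)) * B *
              ENNReal.ofReal (Real.exp ((1 / 2) ^ K)) := mul_le_mul' ih (hfar K h)
          _ = _ := by
            rw [mul_right_comm, ← ENNReal.ofReal_mul (Real.exp_nonneg _), ← Real.exp_add]
            congr 3; ring
      -- Scale `K` does not separate the points, so the induction hypothesis is dropped: the whole
      -- product is at most that of the `q k`, bounded by `τ K ^ (-a)` and so by `edist x y ^ (-a)`.
      · have hmem : y ∈ Metric.ball x (τ k₀) := by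
          rw [Metric.mem_ball, dist_comm]; exact h.trans_le (hτ hK)
        calc ∏ k ∈ Finset.Ico k₀ (K + 1), R k x y ≤ ∏ k ∈ Finset.Ico k₀ (K + 1), q k :=
              Finset.prod_le_prod' fun k _ => hnear k
          _ ≤ ∏ k ∈ Finset.range (K + 1), q k := by
              refine Finset.prod_le_prod_of_subset_of_one_le' ?_ fun k _ _ => hq1 k
              rw [Finset.range_eq_Ico]
              exact Finset.Ico_subset_Ico_left (Nat.zero_le _)
          _ ≤ ENNReal.ofReal (τ K) ^ (-a) := hq K
          _ ≤ edist x y ^ (-a) := by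
              rw [ENNReal.rpow_neg, ENNReal.rpow_neg, ENNReal.inv_le_inv, edist_dist]
              exact ENNReal.rpow_le_rpow (ENNReal.ofReal_le_ofReal h.le) ha
          _ ≤ B := by
              rw [hB, Set.indicator_of_mem hmem]; exact le_add_self
          _ ≤ _ := by
              refine le_mul_of_one_le_left zero_le ?_
              rw [← ENNReal.ofReal_one]
              refine ENNReal.ofReal_le_ofReal (Real.one_le_exp ?_)
              have : ((1 : ℝ) / 2) ^ (K + 1) ≤ (1 / 2) ^ k₀ :=
                pow_le_pow_of_le_one (by norm_num) (by norm_num) (by omega)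
              linarith
  refine (key K hK).trans ?_
  gcongr
  have : (0 : ℝ) ≤ 2 * (1 / 2) ^ K := by positivity
  linarith

/-- By `prod_pair_le` the product is nearly `1`, plus `|x - y|^(-a)` on `|x - y| < τ k₀`. Since `a <
1`, that near part has vanishing integral as `k₀ → ∞`, which gives the second moment. Against the
kernel of order `s` it becomes one of order `s + a < 1`, still integrable, which gives the energy.
-/
theorem moment_bounds_of_pair {J : Set ℝ} (hJm : MeasurableSet J)
    (hJ1 : ∀ x ∈ J, ∀ y ∈ J, dist x y < 1) (hJt : volume J ≠ ∞)
    (hτ : Antitone τ) (hτlim : Tendsto τ atTop (𝓝 0)) (ha : 0 < a)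
    (hfar : ∀ k, ∀ x ∈ J, ∀ y ∈ J, τ k ≤ dist x y →
      R k x y ≤ ENNReal.ofReal (Real.exp ((1 / 2) ^ k)))
    (hnear : ∀ k, ∀ x ∈ J, ∀ y ∈ J, R k x y ≤ q k) (hq1 : ∀ k, 1 ≤ q k)
    (hq : ∀ k, ∏ j ∈ Finset.range (k + 1), q j ≤ ENNReal.ofReal (τ k) ^ (-a))
    {s : ℝ} (hs : 0 < s) (hsa : s + a < 1) (δ : ℝ≥0∞) (hδ : δ ≠ 0) :
    ∃ k₀, (∀ K, ∫⁻ x in J, ∫⁻ y in J, ∏ k ∈ Finset.Ico k₀ K, R k x y ≤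
        volume J * volume J + δ) ∧
      ∃ C : ℝ≥0∞, C ≠ ∞ ∧ ∀ K, ∫⁻ x in J, ∫⁻ y in J, edist x y ^ (-s) *
        ∏ k ∈ Finset.Ico k₀ K, R k x y ≤ C := by
  set v := volume J with hv
  set Q : ℕ → ℝ≥0∞ := fun k => ENNReal.ofReal (Real.exp (2 * (1 / 2) ^ k)) with hQ
  have hprod : ∀ k₀ K, ∀ x ∈ J, ∀ y ∈ J, ∏ k ∈ Finset.Ico k₀ K, R k x y ≤ Q k₀ *
      (1 + (Metric.ball x (τ k₀)).indicator (fun y => edist x y ^ (-a)) y) :=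
    fun k₀ K x hx y hy => prod_pair_le hτ ha.le (fun k => hfar k x hx y hy)
      (fun k => hnear k x hx y hy) hq1 hq k₀ K
  have hedm : ∀ (b x : ℝ), Measurable fun y => edist x y ^ (-b) := fun b x =>
    (measurable_const.edist measurable_id).pow_const _
  have hlim : Tendsto (fun k₀ => Q k₀ * (v * v + v * rieszIntegral a (τ k₀))) atTop
      (𝓝 (1 * (v * v + v * 0))) := by
    have hQlim : Tendsto Q atTop (𝓝 1) := by
      have h1 : Tendsto (fun k : ℕ => Real.exp (2 * (1 / 2) ^ k)) atTop (𝓝 1) := by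
        have := ((tendsto_pow_atTop_nhds_zero_of_lt_one (r := (1 / 2 : ℝ)) (by norm_num)
          (by norm_num)).const_mul 2).rexp
        simpa using this
      exact ENNReal.ofReal_one ▸ ENNReal.tendsto_ofReal h1
    refine ENNReal.Tendsto.mul hQlim (Or.inl one_ne_zero) ?_ (Or.inr ENNReal.one_ne_top)
    exact tendsto_const_nhds.add (ENNReal.Tendsto.const_mul
      (tendsto_rieszIntegral (by linarith) hτlim) (Or.inr hJt))
  have hvv : v * v ≠ ∞ := ENNReal.mul_ne_top hJt hJt
  have hlt : 1 * (v * v + v * 0) < v * v + δ := by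
    rw [mul_zero, add_zero, one_mul]
    exact ENNReal.lt_add_right hvv hδ
  obtain ⟨k₀, hk₀⟩ := (hlim.eventually_lt_const hlt).exists
  refine ⟨k₀, fun K => ?_, Q k₀ * (v * (rieszIntegral s 1 + rieszIntegral (s + a) 1)), ?_,
    fun K => ?_⟩
  · refine le_trans ?_ hk₀.le
    calc ∫⁻ x in J, ∫⁻ y in J, ∏ k ∈ Finset.Ico k₀ K, R k x y
        ≤ ∫⁻ x in J, Q k₀ * (v + rieszIntegral a (τ k₀)) := by
          refine setLIntegral_mono' hJm fun x hx => ?_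
          calc ∫⁻ y in J, ∏ k ∈ Finset.Ico k₀ K, R k x y
              ≤ ∫⁻ y in J, Q k₀ *
                (1 + (Metric.ball x (τ k₀)).indicator (fun y => edist x y ^ (-a)) y) :=
                setLIntegral_mono' hJm fun y hy => hprod k₀ K x hx y hy
            _ = Q k₀ * (v + ∫⁻ y in J,
                (Metric.ball x (τ k₀)).indicator (fun y => edist x y ^ (-a)) y) := by
                rw [lintegral_const_mul' _ _ ENNReal.ofReal_ne_top,
                  lintegral_add_left measurable_const, setLIntegral_const, one_mul]
            _ ≤ Q k₀ * (v + rieszIntegral a (τ k₀)) := by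
                gcongr
                rw [← setLIntegral_ball_edist_rpow a (τ k₀) x,
                  ← lintegral_indicator Metric.isOpen_ball.measurableSet]
                exact setLIntegral_le_lintegral _ _
      _ = Q k₀ * (v * v + v * rieszIntegral a (τ k₀)) := by
          rw [setLIntegral_const]; ring
  · refine ENNReal.mul_ne_top ENNReal.ofReal_ne_top (ENNReal.mul_ne_top hJt ?_)
    exact ENNReal.add_ne_top.2 ⟨rieszIntegral_ne_top (by linarith) 1, rieszIntegral_ne_top hsa 1⟩
  · calc ∫⁻ x in J, ∫⁻ y in J, edist x y ^ (-s) * ∏ k ∈ Finset.Ico k₀ K, R k x y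
        ≤ ∫⁻ x in J, Q k₀ * (rieszIntegral s 1 + rieszIntegral (s + a) 1) := by
          refine setLIntegral_mono' hJm fun x hx => ?_
          have hsub : J ⊆ Metric.ball x 1 := fun y hy => hJ1 y hy x hx
          calc ∫⁻ y in J, edist x y ^ (-s) * ∏ k ∈ Finset.Ico k₀ K, R k x y
              ≤ ∫⁻ y in J, Q k₀ * (edist x y ^ (-s) + edist x y ^ (-(s + a))) := by
                refine setLIntegral_mono' hJm fun y hy => ?_
                refine (mul_le_mul_right (hprod k₀ K x hx y hy) _).trans ?_
                rw [mul_left_comm, mul_add, mul_one]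
                gcongr
                refine (mul_le_mul_right (Set.indicator_le_self' (fun _ _ => zero_le) y) _).trans ?_
                rcases eq_or_ne (edist x y) 0 with h0 | h0
                · rw [h0, ENNReal.zero_rpow_of_neg (by linarith : -(s + a) < 0)]
                  exact le_top
                · rw [neg_add, ENNReal.rpow_add _ _ h0 (edist_ne_top x y)]
            _ ≤ ∫⁻ y in Metric.ball x 1, Q k₀ * (edist x y ^ (-s) + edist x y ^ (-(s + a))) :=
                lintegral_mono_set hsub
            _ = Q k₀ * (rieszIntegral s 1 + rieszIntegral (s + a) 1) := by
                rw [lintegral_const_mul' _ _ ENNReal.ofReal_ne_top, lintegral_add_left (hedm s x),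
                  setLIntegral_ball_edist_rpow, setLIntegral_ball_edist_rpow]
      _ = _ := by
          rw [setLIntegral_const]; ring

end PairProducts

/-! ### The walk, its blocks and their correlations -/

/-- The weight `e^{2 i π (j + 1) θ}` of the step `g j` in the walk at angle `θ`. -/
noncomputable def circleWeight (θ : ℝ) (j : ℕ) : ℂ :=
  Complex.exp (2 * Complex.I * (Real.pi : ℂ) * ((j + 1 : ℕ) : ℂ) * (θ : ℂ))

theorem angularWalk_eq (g : ℕ → ℂ) (n : ℕ) (θ : ℝ) :
    angularWalk g n θ = ∑ j ∈ Finset.range n, g j * circleWeight θ j := rfl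

theorem circleWeight_eq_exp_ofReal_mul_I (θ : ℝ) (j : ℕ) :
    circleWeight θ j = Complex.exp (((2 * Real.pi * (j + 1) * θ : ℝ) : ℂ) * Complex.I) := by
  rw [circleWeight]; congr 1; push_cast; ring

theorem norm_circleWeight (θ : ℝ) (j : ℕ) : ‖circleWeight θ j‖ = 1 := by
  rw [circleWeight_eq_exp_ofReal_mul_I, Complex.norm_exp_ofReal_mul_I]

theorem continuous_circleWeight (j : ℕ) : Continuous fun θ => circleWeight θ j := by
  unfold circleWeight; fun_prop

theorem conj_circleWeight_mul (x y : ℝ) (j : ℕ) :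
    conj (circleWeight x j) * circleWeight y j = circleWeight (y - x) j := by
  rw [circleWeight_eq_exp_ofReal_mul_I, circleWeight_eq_exp_ofReal_mul_I,
    circleWeight_eq_exp_ofReal_mul_I, ← Complex.exp_conj, ← Complex.exp_add]
  congr 1
  rw [map_mul, Complex.conj_ofReal, Complex.conj_I]
  push_cast; ring

/-- A geometric sum of ratio `w = e^(2πit)`, where `|w - 1| = 2|sin πt| ≥ 4|t|` by Jordan's
inequality, valid for `|t| ≤ 1/2`. The bound does not grow with the block: this is the source of
decorrelation. -/
theorem norm_sum_circleWeight_le {t : ℝ} (ht0 : t ≠ 0) (ht : |t| ≤ 1 / 2) (m n : ℕ) :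
    ‖∑ j ∈ Finset.Ico m n, circleWeight t j‖ ≤ 1 / (2 * |t|) := by
  rcases le_or_gt n m with hmn | hmn
  · rw [Finset.Ico_eq_empty_of_le hmn, Finset.sum_empty, norm_zero]; positivity
  set w : ℂ := Complex.exp (Complex.I * ((2 * Real.pi * t : ℝ) : ℂ)) with hw
  have hpow : ∀ j, circleWeight t j = w * w ^ j := by
    intro j
    rw [hw, ← Complex.exp_nat_mul, ← Complex.exp_add, circleWeight]
    congr 1; push_cast; ring
  have hwn : ‖w‖ = 1 := by
    rw [hw, mul_comm, Complex.norm_exp_ofReal_mul_I]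
  have htp : 0 < |t| := abs_pos.2 ht0
  have hsin : 4 * |t| ≤ ‖w - 1‖ := by
    rw [hw, Complex.norm_exp_I_mul_ofReal_sub_one, Real.norm_eq_abs, abs_mul, abs_two]
    have h1 : 2 * Real.pi * t / 2 = Real.pi * t := by ring
    have h3 : |Real.sin (Real.pi * t)| = Real.sin (Real.pi * |t|) := by
      have hnn : 0 ≤ Real.sin (Real.pi * |t|) := by
        apply Real.sin_nonneg_of_nonneg_of_le_pi
        · positivity
        · nlinarith [Real.pi_pos]
      rcases abs_cases t with ⟨h, _⟩ | ⟨h, _⟩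
      · rw [h] at hnn ⊢; exact abs_of_nonneg hnn
      · rw [h] at hnn ⊢
        rw [mul_neg, Real.sin_neg] at hnn ⊢
        exact abs_of_nonpos (by linarith)
    have h2 := Real.mul_le_sin (x := Real.pi * |t|) (by positivity)
      (by nlinarith [Real.pi_pos])
    have h4 : 2 / Real.pi * (Real.pi * |t|) = 2 * |t| := by
      field_simp
    rw [h1, h3]; linarith
  have hne : w ≠ 1 := by
    rintro h
    rw [h, sub_self, norm_zero] at hsin
    linarith
  simp only [hpow, ← Finset.mul_sum]
  rw [geom_sum_Ico hne hmn.le, norm_mul, hwn, one_mul, norm_div]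
  have hnum : ‖w ^ n - w ^ m‖ ≤ 2 := by
    refine (norm_sub_le _ _).trans ?_
    rw [norm_pow, norm_pow, hwn]; norm_num
  calc ‖w ^ n - w ^ m‖ / ‖w - 1‖ ≤ 2 / (4 * |t|) := by gcongr
    _ = 1 / (2 * |t|) := by field_simp; norm_num

theorem norm_angularWalk_le (g : ℕ → ℂ) (n : ℕ) (θ : ℝ) :
    ‖angularWalk g n θ‖ ≤ ∑ j ∈ Finset.range n, ‖g j‖ := by
  rw [angularWalk_eq]
  refine (norm_sum_le _ _).trans (le_of_eq (Finset.sum_congr rfl fun j _ => ?_))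
  rw [norm_mul, norm_circleWeight, mul_one]

section BlockWalk

variable {Ω : Type*} {G : ℕ → Ω → ℂ}

/-- The contribution `∑_{m ≤ j < n} G_j e^{2 i π (j + 1) θ}` of a block of steps. -/
noncomputable def blockWalk (G : ℕ → Ω → ℂ) (m n : ℕ) (θ : ℝ) (ω : Ω) : ℂ :=
  ∑ j ∈ Finset.Ico m n, G j ω * circleWeight θ j

/-- Measurability for the σ-algebra of the block's own steps is what independence of disjoint blocks
requires. -/
theorem measurable_blockWalk_iSup (m n : ℕ) (θ : ℝ) :
    Measurable[⨆ j ∈ (Finset.Ico m n : Set ℕ), MeasurableSpace.comap (G j) inferInstance]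
      (blockWalk G m n θ) := by
  unfold blockWalk
  refine Finset.measurable_fun_sum _ fun j hj => ?_
  refine Measurable.mul_const ?_ _
  exact (comap_measurable (G j)).mono
    (le_iSup₂ (f := fun j (_ : j ∈ (Finset.Ico m n : Set ℕ)) =>
      MeasurableSpace.comap (G j) inferInstance) j (by exact_mod_cast hj)) le_rfl

theorem continuous_blockWalk (m n : ℕ) (ω : Ω) : Continuous fun θ => blockWalk G m n θ ω := by
  unfold blockWalk
  exact continuous_finsetSum _ fun j _ => continuous_const.mul (continuous_circleWeight j)

theorem angularWalk_add_blockWalk {m n : ℕ} (hmn : m ≤ n) (θ : ℝ) (ω : Ω) :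
    angularWalk (fun j => G j ω) n θ = angularWalk (fun j => G j ω) m θ + blockWalk G m n θ ω := by
  rw [angularWalk_eq, angularWalk_eq, blockWalk, Finset.sum_range_add_sum_Ico _ hmn]

end BlockWalk

section Blocks

variable {Ω : Type*} [MeasurableSpace Ω] {P : Measure Ω} {G : ℕ → Ω → ℂ}

/-- Borel–Cantelli at the crude level `j`; the constant absorbs the finitely many exceptions. -/
theorem ae_exists_norm_le_add (hlaw : ∀ j, HasLaw (G j) stdComplexGaussian P)
    (hindep : iIndepFun G P) : ∀ᵐ ω ∂P, ∃ C : ℝ, 0 ≤ C ∧ ∀ j, ‖G j ω‖ ≤ C + j := by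
  have hP : ∀ j : ℕ, P {ω | (j : ℝ) ≤ ‖G j ω‖} ≤ ENNReal.ofReal (Real.exp (-(j : ℝ) / 2)) := by
    intro j
    have := measure_norm_sum_mul_ge_le hlaw hindep {j} (fun _ => 1) (v := 1)
      (by simp) (r := j) (by positivity)
    simp only [Finset.sum_singleton, mul_one] at this
    refine this.trans (ENNReal.ofReal_le_ofReal (Real.exp_le_exp.2 ?_))
    rw [neg_div, neg_div, neg_le_neg_iff]
    have h1 : (j : ℝ) ≤ (j : ℝ) ^ 2 := by exact_mod_cast Nat.le_self_pow two_ne_zero j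
    linarith
  have hsum : ∑' j : ℕ, P {ω | (j : ℝ) ≤ ‖G j ω‖} ≠ ∞ := by
    refine ne_top_of_le_ne_top ?_ (ENNReal.tsum_le_tsum hP)
    have hs : Summable fun j : ℕ => Real.exp (-(j : ℝ) / 2) := by
      have := Real.summable_exp_nat_mul_iff.2 (show (-(1 / 2) : ℝ) < 0 by norm_num)
      refine this.congr fun j => ?_
      congr 1; ring
    rw [← ENNReal.ofReal_tsum_of_nonneg (fun _ => Real.exp_nonneg _) hs]
    exact ENNReal.ofReal_ne_top
  filter_upwards [ae_eventually_notMem hsum] with ω hω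
  obtain ⟨m, hm⟩ := eventually_atTop.1 hω
  refine ⟨∑ j ∈ Finset.range m, ‖G j ω‖, Finset.sum_nonneg fun _ _ => norm_nonneg _, fun j => ?_⟩
  rcases lt_or_ge j m with h | h
  · have := Finset.single_le_sum (f := fun j => ‖G j ω‖) (fun _ _ => norm_nonneg _)
      (Finset.mem_range.2 h)
    have hj : (0 : ℝ) ≤ j := by positivity
    have h0 : ‖G j ω‖ ≤ ∑ j ∈ Finset.range m, ‖G j ω‖ := this
    linarith
  · have h1 := hm j h
    simp only [not_le] at h1
    have : 0 ≤ ∑ j ∈ Finset.range m, ‖G j ω‖ := Finset.sum_nonneg fun _ _ => norm_nonneg _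
    linarith

/-- A crude bound, uniform in the angle. It controls the steps before a block in the lower bound and
the Lipschitz constant of the walk in the upper bound. -/
theorem ae_eventually_sum_norm_le (hlaw : ∀ j, HasLaw (G j) stdComplexGaussian P)
    (hindep : iIndepFun G P) :
    ∀ᵐ ω ∂P, ∀ᶠ n : ℕ in atTop, ∑ j ∈ Finset.range n, ‖G j ω‖ ≤ (n : ℝ) ^ 3 := by
  filter_upwards [ae_exists_norm_le_add hlaw hindep] with ω ⟨C, hC, h⟩
  filter_upwards [eventually_ge_atTop ⌈C⌉₊, eventually_ge_atTop 2] with n hn hn2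
  have hCn : C ≤ n := (Nat.le_ceil C).trans (by exact_mod_cast hn)
  have hn2' : (2 : ℝ) ≤ n := by exact_mod_cast hn2
  calc ∑ j ∈ Finset.range n, ‖G j ω‖ ≤ ∑ _j ∈ Finset.range n, (2 * n : ℝ) := by
        refine Finset.sum_le_sum fun j hj => (h j).trans ?_
        have : (j : ℝ) ≤ n := by exact_mod_cast (Finset.mem_range.1 hj).le
        linarith
    _ = 2 * (n : ℝ) ^ 2 := by simp; ring
    _ ≤ (n : ℝ) ^ 3 := by nlinarith [sq_nonneg (n : ℝ)]

/-- Events determined by disjoint blocks of an independent sequence are independent. -/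
theorem measure_biInter_of_disjoint_blocks (hG : ∀ j, Measurable (G j)) (hindep : iIndepFun G P)
    {S : ℕ → Set ℕ} (hS : Pairwise (Function.onFun Disjoint S)) {A : ℕ → Set Ω}
    (hA : ∀ k, MeasurableSet[⨆ j ∈ S k, MeasurableSpace.comap (G j) inferInstance] (A k))
    (T : Finset ℕ) : P (⋂ k ∈ T, A k) = ∏ k ∈ T, P (A k) := by
  classical
  have := hindep.isProbabilityMeasure
  induction T using Finset.induction_on with
  | empty => simp
  | insert k T hk ih =>
    rw [Finset.prod_insert hk, ← ih, Finset.set_biInter_insert]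
    have hdisj : Disjoint (S k) (⋃ i ∈ T, S i) := by
      rw [Set.disjoint_iUnion₂_right]
      exact fun i hi => hS fun h => hk (h ▸ hi)
    have hi := indep_iSup_of_disjoint (fun j => (hG j).comap_le) hindep hdisj
    refine (Indep_iff _ _ P).1 hi _ _ (hA k) ?_
    refine Finset.measurableSet_biInter T fun i hiT => ?_
    have hle : (⨆ j ∈ S i, MeasurableSpace.comap (G j) inferInstance) ≤
        ⨆ j ∈ ⋃ i ∈ T, S i, MeasurableSpace.comap (G j) inferInstance :=
      biSup_mono fun j hj => Set.mem_iUnion₂.2 ⟨i, hiT, hj⟩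
    exact hle _ (hA i)

theorem measurable_uncurry_blockWalk (hG : ∀ j, Measurable (G j)) (m n : ℕ) :
    Measurable fun q : Ω × ℝ => blockWalk G m n q.2 q.1 := by
  unfold blockWalk
  exact Finset.measurable_fun_sum _ fun j _ => ((hG j).comp measurable_fst).mul
    ((continuous_circleWeight j).measurable.comp measurable_snd)

theorem measure_blockWalk_ge (hlaw : ∀ j, HasLaw (G j) stdComplexGaussian P)
    (hindep : iIndepFun G P) (m : ℕ) {N : ℕ} (hN : 0 < N) (θ : ℝ) {r : ℝ} (hr : 0 ≤ r) :
    P {ω | r * Real.sqrt N ≤ ‖blockWalk G m (m + N) θ ω‖} =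
      ENNReal.ofReal (Real.exp (-r ^ 2 / 2)) := by
  have hN' : (0 : ℝ) < N := by exact_mod_cast hN
  refine (measure_norm_sum_mul_ge_eq hlaw hindep (Finset.Ico m (m + N)) (circleWeight θ)
    (v := N) hN' ?_ (by positivity)).trans ?_
  · simp [norm_circleWeight]
  · rw [mul_pow, Real.sq_sqrt hN'.le]
    congr 2; field_simp

/-- At distance at least `τ` the geometric sum makes the normalised covariance at most `ρ = 1 /
(2τN)`, and the decorrelation bound applies; `1 < τN` is the condition `2ρ < 1`. -/
theorem pairRatio_blockWalk_le (hlaw : ∀ j, HasLaw (G j) stdComplexGaussian P)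
    (hindep : iIndepFun G P) (m : ℕ) {N : ℕ} (hN : 0 < N) {x y τ r : ℝ} (hτ0 : 0 < τ)
    (hτ : τ ≤ dist x y) (hxy : dist x y ≤ 1 / 2) (hτN : 1 < τ * N) (hr : 0 ≤ r) :
    pairRatio P (ENNReal.ofReal (Real.exp (-r ^ 2 / 2)))
      {ω | r * Real.sqrt N ≤ ‖blockWalk G m (m + N) x ω‖}
      {ω | r * Real.sqrt N ≤ ‖blockWalk G m (m + N) y ω‖} ≤
      ENNReal.ofReal (Real.exp (r ^ 2 / (2 * (τ * N))) / (1 - 1 / (τ * N))) := by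
  have hN' : (0 : ℝ) < N := by exact_mod_cast hN
  set ρ : ℝ := 1 / (2 * (τ * N)) with hρdef
  have hρ : 2 * ρ < 1 := by
    have h1 : (τ * N)⁻¹ < 1 := inv_lt_one_of_one_lt₀ hτN
    have h2 : 2 * ρ = (τ * N)⁻¹ := by rw [hρdef]; field_simp
    rwa [h2]
  have hne : y - x ≠ 0 := by
    intro h
    rw [dist_comm, Real.dist_eq, h, abs_zero] at hτ
    linarith
  have hd : |y - x| = dist x y := by rw [dist_comm, Real.dist_eq]
  have hcorr : ‖∑ j ∈ Finset.Ico m (m + N), conj (circleWeight x j) * circleWeight y j‖ ≤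
      ρ * (Finset.Ico m (m + N)).card := by
    simp only [conj_circleWeight_mul]
    refine (norm_sum_circleWeight_le hne (by rw [hd]; exact hxy) _ _).trans ?_
    rw [Nat.card_Ico, Nat.add_sub_cancel_left, hd, hρdef]
    calc 1 / (2 * dist x y) ≤ 1 / (2 * τ) := by gcongr
      _ = 1 / (2 * (τ * N)) * N := by field_simp
  have h1 := measure_norm_sum_mul_ge_and_le hlaw hindep (Finset.Ico m (m + N))
    (Finset.nonempty_Ico.2 (by omega)) (circleWeight x) (circleWeight y)
    (fun j _ => norm_circleWeight x j) (fun j _ => norm_circleWeight y j) hcorr hρ hr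
  rw [Nat.card_Ico, Nat.add_sub_cancel_left] at h1
  have hpp : ENNReal.ofReal (Real.exp (-r ^ 2 / 2)) * ENNReal.ofReal (Real.exp (-r ^ 2 / 2)) =
      ENNReal.ofReal (Real.exp (-r ^ 2)) := by
    rw [← ENNReal.ofReal_mul (Real.exp_nonneg _), ← Real.exp_add]; congr 2; ring
  rw [pairRatio, hpp]
  refine ENNReal.div_le_of_le_mul' ?_
  rw [← ENNReal.ofReal_mul (Real.exp_nonneg _)]
  refine h1.trans (le_of_eq ?_)
  have e1 : ρ * r ^ 2 = r ^ 2 / (2 * (τ * N)) := by rw [hρdef]; ring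
  have e2 : 2 * ρ = 1 / (τ * N) := by rw [hρdef]; field_simp
  rw [e1, e2]

end Blocks

/-! ### Choice of the block lengths -/

/-- A block of length `N` after `n` steps, the `k`-th of a sequence, is long enough for the
second moment method at the level `√(2 β log N)`. -/
structure LongBlock (α β a κ : ℝ) (k n N : ℕ) : Prop where
  two_le : 2 ≤ N
  le : n ≤ N
  rpow_le : ((n : ℝ) ^ k) ^ β * (N : ℝ) ^ β ≤ (N : ℝ) ^ (κ * a)
  correlation_le : Real.exp (2 * β * Real.log N / (2 * ((N : ℝ) ^ (-κ) * N))) /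
    (1 - 1 / ((N : ℝ) ^ (-κ) * N)) ≤ Real.exp ((1 / 2) ^ k)
  threshold_lt : threshold α (n + N) + (n : ℝ) ^ 3 < Real.sqrt (2 * β * Real.log N) * Real.sqrt N

/-- For `N` large, prefixing `n` steps changes `N` and `log N` by factors at most `1 + η`; the gap
between `√α` and `√β` absorbs these and the constant `c`. -/
theorem eventually_threshold_add_lt {α β : ℝ} (hα : 0 < α) (hαβ : α < β) (n : ℕ) (c : ℝ) :
    ∀ᶠ N : ℕ in atTop,
      threshold α (n + N) + c < Real.sqrt (2 * β * Real.log N) * Real.sqrt N := by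
  have hs : Real.sqrt α < Real.sqrt β := Real.sqrt_lt_sqrt hα.le hαβ
  have hs0 : 0 < Real.sqrt α := Real.sqrt_pos.2 hα
  obtain ⟨η, hη, hηs⟩ : ∃ η : ℝ, 0 < η ∧ (1 + η) * Real.sqrt α < Real.sqrt β := by
    refine ⟨(Real.sqrt β / Real.sqrt α - 1) / 2, ?_, ?_⟩
    · have : 1 < Real.sqrt β / Real.sqrt α := (one_lt_div hs0).2 hs
      linarith
    · have h1 : Real.sqrt β = Real.sqrt β / Real.sqrt α * Real.sqrt α := by field_simp
      nlinarith [(one_lt_div hs0).2 hs]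
  have hlog : Tendsto (fun N : ℕ => Real.log N) atTop atTop :=
    Real.tendsto_log_atTop.comp tendsto_natCast_atTop_atTop
  have hL : Tendsto (fun N : ℕ => Real.sqrt (2 * (N : ℝ) * Real.log N)) atTop atTop := by
    refine Real.tendsto_sqrt_atTop.comp ?_
    exact (tendsto_natCast_atTop_atTop.const_mul_atTop two_pos).atTop_mul_atTop₀ hlog
  have hd : 0 < Real.sqrt β - (1 + η) * Real.sqrt α := by linarith
  filter_upwards [hL.eventually_gt_atTop (c / (Real.sqrt β - (1 + η) * Real.sqrt α)),
    (tendsto_natCast_atTop_atTop (R := ℝ)).eventually_ge_atTop (n / η),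
    hlog.eventually_ge_atTop (Real.log (1 + η) / η), eventually_ge_atTop 1] with N h1 h2 h3 hN
  have hN0 : (0 : ℝ) < N := by exact_mod_cast hN
  rw [div_lt_iff₀ hd] at h1
  rw [div_le_iff₀ hη] at h2 h3
  have hlogN : 0 ≤ Real.log N := Real.log_natCast_nonneg N
  have h4 : ((n + N : ℕ) : ℝ) ≤ (1 + η) * N := by push_cast; linarith
  have hnN0 : (0 : ℝ) < (n + N : ℕ) := by exact_mod_cast (by omega : 0 < n + N)
  have h5 : Real.log ((n + N : ℕ) : ℝ) ≤ (1 + η) * Real.log N := by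
    calc Real.log ((n + N : ℕ) : ℝ) ≤ Real.log ((1 + η) * N) := Real.log_le_log hnN0 h4
      _ = Real.log (1 + η) + Real.log N := Real.log_mul (by positivity) hN0.ne'
      _ ≤ _ := by linarith
  have h6 : threshold α (n + N) ≤ (1 + η) * Real.sqrt α * Real.sqrt (2 * (N : ℝ) * Real.log N) := by
    rw [threshold]
    refine Real.sqrt_le_iff.2 ⟨by positivity, ?_⟩
    rw [mul_pow, mul_pow, Real.sq_sqrt hα.le, Real.sq_sqrt (by positivity)]
    have h7 : ((n + N : ℕ) : ℝ) * Real.log ((n + N : ℕ) : ℝ) ≤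
        ((1 + η) * N) * ((1 + η) * Real.log N) :=
      mul_le_mul h4 h5 (Real.log_natCast_nonneg _) (by positivity)
    calc 2 * α * ((n + N : ℕ) : ℝ) * Real.log ((n + N : ℕ) : ℝ) =
          2 * α * (((n + N : ℕ) : ℝ) * Real.log ((n + N : ℕ) : ℝ)) := by ring
      _ ≤ 2 * α * (((1 + η) * N) * ((1 + η) * Real.log N)) := by gcongr
      _ = _ := by ring
  have h8 : Real.sqrt (2 * β * Real.log N) * Real.sqrt N =
      Real.sqrt β * Real.sqrt (2 * (N : ℝ) * Real.log N) := by
    have hβ : 0 ≤ β := (hα.trans hαβ).le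
    rw [← Real.sqrt_mul (by positivity), ← Real.sqrt_mul hβ]
    congr 1; ring
  rw [h8]
  nlinarith

/-- With `n` and `k` fixed, `n^(kβ)` is a constant beaten by `N^(κa - β)`, and with `τ = N^(-κ)` the
correlation exponent is `β log N / N^(1-κ)`, which tends to `0` because `κ < 1`. -/
theorem eventually_longBlock {α β a κ : ℝ} (hα : 0 < α) (hαβ : α < β) (hκ : κ < 1)
    (hκa : β < κ * a) (k n : ℕ) : ∀ᶠ N : ℕ in atTop, LongBlock α β a κ k n N := by
  have hcast : Tendsto (fun N : ℕ => (N : ℝ)) atTop atTop := tendsto_natCast_atTop_atTop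
  have h2 : ∀ᶠ N : ℕ in atTop, ((n : ℝ) ^ k) ^ β ≤ (N : ℝ) ^ (κ * a - β) :=
    ((tendsto_rpow_atTop (by linarith : 0 < κ * a - β)).comp hcast).eventually_ge_atTop _
  have hprod : ∀ᶠ N : ℕ in atTop, (N : ℝ) ^ (-κ) * N = (N : ℝ) ^ (1 - κ) := by
    filter_upwards [eventually_ge_atTop 1] with N hN
    have hN0 : (0 : ℝ) < N := by exact_mod_cast hN
    rw [sub_eq_neg_add, Real.rpow_add hN0, Real.rpow_one]
  have h3 : Tendsto (fun N : ℕ => Real.exp (β * (Real.log N / (N : ℝ) ^ (1 - κ))) /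
      (1 - 1 / (N : ℝ) ^ (1 - κ))) atTop (𝓝 (Real.exp (β * 0) / (1 - 0))) := by
    have h4 : Tendsto (fun N : ℕ => Real.log N / (N : ℝ) ^ (1 - κ)) atTop (𝓝 0) :=
      ((isLittleO_log_rpow_atTop (by linarith : 0 < 1 - κ)).tendsto_div_nhds_zero).comp hcast
    have h5 : Tendsto (fun N : ℕ => 1 / (N : ℝ) ^ (1 - κ)) atTop (𝓝 0) := by
      simp only [one_div]
      exact tendsto_inv_atTop_zero.comp
        ((tendsto_rpow_atTop (by linarith : 0 < 1 - κ)).comp hcast)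
    exact ((h4.const_mul β).rexp).div (h5.const_sub 1) (by norm_num)
  have h6 : Real.exp (β * 0) / (1 - 0) < Real.exp ((1 / 2) ^ k) := by
    rw [mul_zero, Real.exp_zero, sub_zero, div_one]
    exact Real.one_lt_exp_iff.2 (by positivity)
  filter_upwards [eventually_ge_atTop 2, eventually_ge_atTop n, h2, hprod,
    h3.eventually_lt_const h6, eventually_threshold_add_lt hα hαβ n ((n : ℝ) ^ 3)]
    with N c1 c2 c3 c4 c5 c6
  have hN0 : (0 : ℝ) < N := by exact_mod_cast (by omega : 0 < N)
  refine ⟨c1, c2, ?_, ?_, c6⟩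
  · calc ((n : ℝ) ^ k) ^ β * (N : ℝ) ^ β ≤ (N : ℝ) ^ (κ * a - β) * (N : ℝ) ^ β := by gcongr
      _ = (N : ℝ) ^ (κ * a) := by rw [← Real.rpow_add hN0, sub_add_cancel]
  · rw [c4]
    refine le_trans (le_of_eq ?_) c5.le
    congr 2
    field_simp

/-- There is a sequence of times whose consecutive blocks are all long. -/
theorem exists_longBlock_seq {α β a κ : ℝ} (hα : 0 < α) (hαβ : α < β) (hκ : κ < 1)
    (hκa : β < κ * a) :
    ∃ n N : ℕ → ℕ, (∀ k, n (k + 1) = n k + N k) ∧ ∀ k, LongBlock α β a κ k (n k) (N k) := by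
  choose f hf using fun k n => (eventually_longBlock hα hαβ hκ hκa k n).exists
  let n : ℕ → ℕ := fun k => Nat.rec 0 (fun k m => m + f k m) k
  exact ⟨n, fun k => f k (n k), fun k => rfl, fun k => hf k (n k)⟩

/-! ### Lower bound for the dimension -/

section LowerBound

variable {Ω : Type*} [MeasurableSpace Ω] {P : Measure Ω} {G : ℕ → Ω → ℂ}

theorem ae_le_dimH_of_measurable (hG : ∀ j, Measurable (G j))
    (hlaw : ∀ j, HasLaw (G j) stdComplexGaussian P) (hindep : iIndepFun G P)
    {α s : ℝ} (hα : 0 < α) (hs : 0 < s) (hsα : s < 1 - α) :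
    ∀ᵐ ω ∂P, ENNReal.ofReal s ≤ dimH (exceptionalAngles α fun j => G j ω) := by
  have := hindep.isProbabilityMeasure
  -- The parameters satisfy `α < β < a < 1 - s` and `β / a < κ < 1`. The gap `α < β` pays for the
  -- past steps, `s + a < 1` makes the energy finite, `κ < 1` decorrelates angles at distance
  -- `N^(-κ)`, and `β < κa` lets `N^(-κ)` to the power `-a` dominate the inverse probability `N^β`
  -- with room for all earlier blocks.
  obtain ⟨β, hαβ, hβ⟩ : ∃ β, α < β ∧ β < 1 - s := exists_between (by linarith)
  obtain ⟨a, hβa, ha⟩ : ∃ a, β < a ∧ a < 1 - s := exists_between hβ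
  have hβ0 : 0 < β := hα.trans hαβ
  have ha0 : 0 < a := hβ0.trans hβa
  obtain ⟨κ, hκa, hκ⟩ : ∃ κ, β / a < κ ∧ κ < 1 := exists_between ((div_lt_one ha0).2 hβa)
  rw [div_lt_iff₀ ha0] at hκa
  have hκ0 : 0 < κ := by
    by_contra! h
    nlinarith
  obtain ⟨n, N, hn, hlong⟩ := exists_longBlock_seq hα hαβ hκ hκa
  have hN0 : ∀ k, 0 < N k := fun k => by have := (hlong k).two_le; omega
  have hN0' : ∀ k, (0 : ℝ) < N k := fun k => by exact_mod_cast hN0 k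
  have hnmono : StrictMono n := strictMono_nat_of_lt_succ fun k => by
    rw [hn]; have := hN0 k; omega
  have hNmono : Monotone N := monotone_nat_of_le_succ fun k => by
    have h1 := (hlong (k + 1)).le
    rw [hn] at h1; omega
  have hNlim : Tendsto N atTop atTop :=
    tendsto_atTop_mono (fun k => (hlong k).le) hnmono.tendsto_atTop
  set r : ℕ → ℝ := fun k => Real.sqrt (2 * β * Real.log (N k)) with hr
  have hr0 : ∀ k, 0 ≤ r k := fun k => Real.sqrt_nonneg _
  have hr2 : ∀ k, r k ^ 2 = 2 * β * Real.log (N k) := fun k =>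
    Real.sq_sqrt (by have := Real.log_natCast_nonneg (N k); positivity)
  set p : ℕ → ℝ≥0∞ := fun k => ENNReal.ofReal (Real.exp (-r k ^ 2 / 2)) with hp
  have hp0 : ∀ k, p k ≠ 0 := fun k => by simp [hp, Real.exp_pos]
  have hpt : ∀ k, p k ≠ ∞ := fun k => ENNReal.ofReal_ne_top
  have hpinv : ∀ k, (p k)⁻¹ = ENNReal.ofReal ((N k : ℝ) ^ β) := by
    intro k
    rw [hp]
    simp only
    rw [← ENNReal.ofReal_inv_of_pos (Real.exp_pos _), ← Real.exp_neg, hr2,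
      Real.rpow_def_of_pos (hN0' k)]
    congr 2; ring
  set E : ℕ → ℝ → Set Ω := fun k x =>
    {ω | r k * Real.sqrt (N k) ≤ ‖blockWalk G (n k) (n k + N k) x ω‖} with hE
  have hEm : ∀ k, MeasurableSet {q : Ω × ℝ | q.1 ∈ E k q.2} := fun k =>
    measurableSet_le measurable_const (measurable_uncurry_blockWalk hG _ _).norm
  have hclosed : ∀ k ω, IsClosed {x | ω ∈ E k x} := fun k ω =>
    isClosed_le continuous_const (continuous_blockWalk _ _ ω).norm
  have hprob : ∀ k x, P (E k x) = p k := fun k x =>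
    measure_blockWalk_ge hlaw hindep (n k) (hN0 k) x (hr0 k)
  have hdisj : Pairwise (Function.onFun Disjoint fun k =>
      (Finset.Ico (n k) (n k + N k) : Set ℕ)) := by
    have h1 := hnmono.monotone.pairwise_disjoint_on_Ico_succ
    intro i j hij
    have h2 := h1 hij
    simpa only [Function.onFun, Order.succ_eq_add_one, hn, Finset.coe_Ico] using h2
  have hind : ∀ T : Finset ℕ, ∀ x y,
      P (⋂ k ∈ T, (E k x ∩ E k y)) = ∏ k ∈ T, P (E k x ∩ E k y) := by
    intro T x y
    refine measure_biInter_of_disjoint_blocks hG hindep hdisj (fun k => ?_) T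
    refine MeasurableSet.inter ?_ ?_
    · exact measurable_blockWalk_iSup _ _ x (measurableSet_le measurable_const measurable_norm)
    · exact measurable_blockWalk_iSup _ _ y (measurableSet_le measurable_const measurable_norm)
  set τ : ℕ → ℝ := fun k => (N k : ℝ) ^ (-κ) with hτ
  have hτ0 : ∀ k, 0 < τ k := fun k => Real.rpow_pos_of_pos (hN0' k) _
  have hτanti : Antitone τ := fun i j hij =>
    Real.rpow_le_rpow_of_nonpos (hN0' i) (by exact_mod_cast hNmono hij) (by linarith)
  have hτlim : Tendsto τ atTop (𝓝 0) :=
    (tendsto_rpow_neg_atTop hκ0).comp (tendsto_natCast_atTop_atTop.comp hNlim)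
  have hτN : ∀ k, 1 < τ k * N k := by
    intro k
    have h1 : τ k * N k = (N k : ℝ) ^ (1 - κ) := by
      rw [sub_eq_neg_add, Real.rpow_add (hN0' k), Real.rpow_one]
    rw [h1]
    refine Real.one_lt_rpow ?_ (by linarith)
    exact_mod_cast (hlong k).two_le
  -- Half of the circle suffices, and keeps distances within the range `|t| ≤ 1/2` of the geometric
  -- sum bound.
  have hJd : ∀ x ∈ Set.Icc (0 : ℝ) (1 / 2), ∀ y ∈ Set.Icc (0 : ℝ) (1 / 2), dist x y ≤ 1 / 2 := by
    intro x hx y hy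
    have := Real.dist_le_of_mem_Icc hx hy
    linarith
  have hmoment := moment_bounds_of_pair (J := Set.Icc (0 : ℝ) (1 / 2))
    (R := fun k x y => pairRatio P (p k) (E k x) (E k y)) (q := fun k => (p k)⁻¹)
    measurableSet_Icc (fun x hx y hy => (hJd x hx y hy).trans_lt (by norm_num))
    isCompact_Icc.measure_lt_top.ne hτanti hτlim ha0
    (fun k x hx y hy hxy => by
      refine (pairRatio_blockWalk_le hlaw hindep (n k) (hN0 k) (hτ0 k) hxy (hJd x hx y hy)
        (hτN k) (hr0 k)).trans (ENNReal.ofReal_le_ofReal ?_)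
      rw [hr2]
      exact (hlong k).correlation_le)
    (fun k x _ y _ => by
      rw [pairRatio, div_eq_mul_inv, ENNReal.mul_inv (Or.inl (hp0 k)) (Or.inl (hpt k)), ← mul_assoc]
      refine mul_le_of_le_one_left zero_le ?_
      rw [← ENNReal.mul_inv_cancel (hp0 k) (hpt k)]
      gcongr
      exact (measure_mono Set.inter_subset_left).trans (hprob k x).le)
    (fun k => by
      rw [ENNReal.one_le_inv]
      exact (hprob k 0).ge.trans prob_le_one)
    (fun k => by
      simp only [hpinv]
      rw [← ENNReal.ofReal_prod_of_nonneg (fun j _ => by positivity),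
        ENNReal.ofReal_rpow_of_pos (hτ0 k), Finset.prod_range_succ]
      refine ENNReal.ofReal_le_ofReal ?_
      have h1 : ((N k : ℝ) ^ (-κ)) ^ (-a) = (N k : ℝ) ^ (κ * a) := by
        rw [← Real.rpow_mul (hN0' k).le]; congr 1; ring
      rw [hτ]
      simp only
      rw [h1]
      refine le_trans ?_ (hlong k).rpow_le
      gcongr
      rw [Real.finsetProd_rpow _ _ (fun j _ => by positivity)]
      refine Real.rpow_le_rpow (by positivity) ?_ hβ0.le
      -- Each earlier block ends by time `n k`, so its length is at most `n k`.
      calc ∏ j ∈ Finset.range k, (N j : ℝ) ≤ ∏ _j ∈ Finset.range k, (n k : ℝ) := by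
            refine Finset.prod_le_prod (fun j _ => by positivity) fun j hj => ?_
            have h2 : n (j + 1) ≤ n k := hnmono.monotone (Finset.mem_range.1 hj)
            rw [hn] at h2
            exact_mod_cast (by omega : N j ≤ n k)
        _ = (n k : ℝ) ^ k := by simp)
    hs (by linarith)
  have hmain := ae_exists_hausdorffMeasure_ne_zero hEm hclosed isCompact_Icc
    (by simp) hind (fun k x _ => hprob k x) hp0 hpt hs hmoment
  filter_upwards [hmain, ae_eventually_sum_norm_le hlaw hindep] with ω ⟨k₀, hk₀⟩ hgrowth
  have hdim : ENNReal.ofReal s ≤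
      dimH (Set.Icc (0 : ℝ) (1 / 2) ∩ {x | ∀ k ≥ k₀, ω ∈ E k x}) := by
    have h1 : μH[((Real.toNNReal s : NNReal) : ℝ)]
        (Set.Icc (0 : ℝ) (1 / 2) ∩ {x | ∀ k ≥ k₀, ω ∈ E k x}) ≠ 0 := by
      rwa [Real.coe_toNNReal s hs.le]
    exact le_dimH_of_hausdorffMeasure_ne_zero h1
  refine hdim.trans (dimH_mono ?_)
  rintro x ⟨hx, hxE⟩
  refine ⟨⟨hx.1, hx.2.trans_lt (by norm_num)⟩, ?_⟩
  have hev : ∀ᶠ k in atTop,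
      threshold α (n (k + 1)) < ‖angularWalk (fun j => G j ω) (n (k + 1)) x‖ := by
    filter_upwards [eventually_ge_atTop k₀, hnmono.tendsto_atTop.eventually hgrowth] with k hk hgk
    have h1 : r k * Real.sqrt (N k) ≤ ‖blockWalk G (n k) (n k + N k) x ω‖ := hxE k hk
    have h2 := norm_angularWalk_le (fun j => G j ω) (n k) x
    have h3 := (hlong k).threshold_lt
    rw [hn, angularWalk_add_blockWalk (Nat.le_add_right _ _)]
    have h4 := norm_sub_le_norm_add (blockWalk G (n k) (n k + N k) x ω)
      (angularWalk (fun j => G j ω) (n k) x)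
    rw [add_comm (blockWalk _ _ _ _ _)] at h4
    have h5 : r k * Real.sqrt (N k) =
      Real.sqrt (2 * β * Real.log (N k)) * Real.sqrt (N k) := rfl
    linarith
  exact (hnmono.tendsto_atTop.comp (tendsto_add_atTop_nat 1)).frequently hev.frequently

end LowerBound

/-! ### Upper bound: approximation on a polynomial grid -/

theorem norm_circleWeight_sub_le (x y : ℝ) (j : ℕ) :
    ‖circleWeight x j - circleWeight y j‖ ≤ 2 * Real.pi * (j + 1) * |x - y| := by
  have h1 : circleWeight x j - circleWeight y j =
      circleWeight y j * (circleWeight (x - y) j - 1) := by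
    rw [mul_sub, mul_one, ← conj_circleWeight_mul, ← mul_assoc, Complex.mul_conj',
      norm_circleWeight]
    simp
  rw [h1, norm_mul, norm_circleWeight, one_mul, circleWeight_eq_exp_ofReal_mul_I, mul_comm]
  refine Real.norm_exp_I_mul_ofReal_sub_one_le.trans (le_of_eq ?_)
  rw [Real.norm_eq_abs, abs_mul, abs_of_nonneg (by positivity)]

theorem norm_angularWalk_sub_le (g : ℕ → ℂ) (n : ℕ) (x y : ℝ) :
    ‖angularWalk g n x - angularWalk g n y‖ ≤
      (∑ j ∈ Finset.range n, ‖g j‖) * (2 * Real.pi * n * |x - y|) := by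
  rw [angularWalk_eq, angularWalk_eq, ← Finset.sum_sub_distrib, Finset.sum_mul]
  refine (norm_sum_le _ _).trans (Finset.sum_le_sum fun j hj => ?_)
  rw [← mul_sub, norm_mul]
  have h1 : ((j : ℝ) + 1) ≤ n := by exact_mod_cast Finset.mem_range.1 hj
  have h2 := norm_circleWeight_sub_le x y j
  gcongr
  refine h2.trans ?_
  gcongr

theorem exists_pow_le_lt_pow {K : ℕ} (i₀ : ℕ) {n : ℕ} (hn : i₀ ^ (K + 1) ≤ n) :
    ∃ i ≥ i₀, i ^ (K + 1) ≤ n ∧ n < (i + 1) ^ (K + 1) := by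
  have hex : ∃ j, n < j ^ (K + 1) := ⟨n + 1, (Nat.lt_succ_self n).trans_le
    (Nat.le_self_pow (Nat.succ_ne_zero K) _)⟩
  classical
  have h1 := Nat.find_spec hex
  have h2 : i₀ < Nat.find hex := by
    by_contra! h
    exact absurd (h1.trans_le (Nat.pow_le_pow_left h _)) hn.not_gt
  refine ⟨Nat.find hex - 1, by omega, ?_, ?_⟩
  · exact not_lt.1 (Nat.find_min hex (by omega))
  · rwa [Nat.sub_add_cancel (by omega)]

section UpperBound

variable {Ω : Type*} [MeasurableSpace Ω] {P : Measure Ω} {G : ℕ → Ω → ℂ}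

/-- The difference is one weighted sum: the first `m` weights are differences of nearby unimodular
numbers, of modulus at most `2πm|x - y|`, and the other `n - m` are unimodular. The hypothesis
bounds its total variance. -/
theorem measure_angularWalk_sub_ge_le (hlaw : ∀ j, HasLaw (G j) stdComplexGaussian P)
    (hindep : iIndepFun G P) {m n : ℕ} (hmn : m ≤ n) {x y v r : ℝ} (hr : 0 ≤ r)
    (hle : (m : ℝ) * (2 * Real.pi * m * |x - y|) ^ 2 + (n - m) ≤ v) :
    P {ω | r ≤ ‖angularWalk (fun j => G j ω) n x - angularWalk (fun j => G j ω) m y‖} ≤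
      ENNReal.ofReal (Real.exp (-r ^ 2 / (2 * v))) := by
  set a : ℕ → ℂ := fun j => if j < m then circleWeight x j - circleWeight y j
    else circleWeight x j with ha
  have h1 : ∀ ω, angularWalk (fun j => G j ω) n x - angularWalk (fun j => G j ω) m y =
      ∑ j ∈ Finset.range n, G j ω * a j := by
    intro ω
    rw [angularWalk_eq, angularWalk_eq, ← Finset.sum_range_add_sum_Ico _ hmn,
      ← Finset.sum_range_add_sum_Ico (fun j => G j ω * a j) hmn, add_sub_right_comm,
      ← Finset.sum_sub_distrib]
    congr 1
    · refine Finset.sum_congr rfl fun j hj => ?_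
      rw [ha]; simp only [if_pos (Finset.mem_range.1 hj)]; ring
    · refine Finset.sum_congr rfl fun j hj => ?_
      rw [ha]; simp only [if_neg (not_lt.2 (Finset.mem_Ico.1 hj).1)]
  simp only [h1]
  refine measure_norm_sum_mul_ge_le hlaw hindep _ a (le_trans ?_ hle) hr
  rw [← Finset.sum_range_add_sum_Ico _ hmn]
  refine add_le_add ?_ ?_
  · calc ∑ j ∈ Finset.range m, ‖a j‖ ^ 2
        ≤ ∑ _j ∈ Finset.range m, (2 * Real.pi * m * |x - y|) ^ 2 := by
          refine Finset.sum_le_sum fun j hj => ?_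
          have hj := Finset.mem_range.1 hj
          have h2 : ((j : ℝ) + 1) ≤ m := by exact_mod_cast hj
          rw [ha]; simp only [if_pos hj]
          gcongr
          refine (norm_circleWeight_sub_le x y j).trans ?_
          gcongr
      _ = _ := by simp
  · calc ∑ j ∈ Finset.Ico m n, ‖a j‖ ^ 2 = ∑ _j ∈ Finset.Ico m n, (1 : ℝ) := by
          refine Finset.sum_congr rfl fun j hj => ?_
          rw [ha]; simp only [if_neg (not_lt.2 (Finset.mem_Ico.1 hj).1), norm_circleWeight, one_pow]
      _ = (n : ℝ) - m := by simp [Nat.cast_sub hmn]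
      _ ≤ _ := le_rfl

/-- The walk at times and angles close to those of a polynomial grid. -/
theorem measure_angularWalk_sub_grid_le (hlaw : ∀ j, HasLaw (G j) stdComplexGaussian P)
    (hindep : iIndepFun G P) (K : ℕ) : ∃ c : ℝ, 0 < c ∧ ∀ i n : ℕ, 1 ≤ i → i ^ (K + 1) ≤ n →
      n < (i + 1) ^ (K + 1) → ∀ x y : ℝ, |x - y| ≤ 1 / (i : ℝ) ^ (K + 2) →
      P {ω | Real.sqrt ((i ^ (K + 1) : ℕ) : ℝ) ≤
        ‖angularWalk (fun j => G j ω) n x - angularWalk (fun j => G j ω) (i ^ (K + 1)) y‖} ≤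
      ENNReal.ofReal (Real.exp (-c * i)) := by
  -- The variance is at most `C * i ^ K`: `4π²` comes from the change of angle, `(K+1) 2^K` from the
  -- time gap `(i+1)^(K+1) - i^(K+1)`. The squared level is `i^(K+1)`, one power more, whence a
  -- decay `exp(-i / (2C))`.
  set C : ℝ := 4 * Real.pi ^ 2 + (K + 1) * 2 ^ K with hC
  have hC0 : 0 < C := by positivity
  refine ⟨1 / (2 * C), by positivity, fun i n hi hin hni x y hxy => ?_⟩
  have hi1 : (1 : ℝ) ≤ i := by exact_mod_cast hi
  have hi0 : (0 : ℝ) < i := by linarith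
  refine (measure_angularWalk_sub_ge_le hlaw hindep hin (v := C * (i : ℝ) ^ K)
    (Real.sqrt_nonneg _) ?_).trans (ENNReal.ofReal_le_ofReal (Real.exp_le_exp.2 (le_of_eq ?_)))
  · have h1 : 2 * Real.pi * ((i ^ (K + 1) : ℕ) : ℝ) * |x - y| ≤ 2 * Real.pi / i := by
      calc 2 * Real.pi * ((i ^ (K + 1) : ℕ) : ℝ) * |x - y|
          ≤ 2 * Real.pi * ((i ^ (K + 1) : ℕ) : ℝ) * (1 / (i : ℝ) ^ (K + 2)) := by gcongr
        _ = 2 * Real.pi / i := by push_cast; field_simp; ring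
    have h2 : ((i ^ (K + 1) : ℕ) : ℝ) * (2 * Real.pi * ((i ^ (K + 1) : ℕ) : ℝ) * |x - y|) ^ 2 ≤
        4 * Real.pi ^ 2 * (i : ℝ) ^ K := by
      calc _ ≤ ((i ^ (K + 1) : ℕ) : ℝ) * (2 * Real.pi / i) ^ 2 := by gcongr
        _ = 4 * Real.pi ^ 2 * (i : ℝ) ^ K / i := by push_cast; field_simp; ring
        _ ≤ 4 * Real.pi ^ 2 * (i : ℝ) ^ K := div_le_self (by positivity) hi1
    have h3 : (n : ℝ) - ((i ^ (K + 1) : ℕ) : ℝ) ≤ (K + 1) * 2 ^ K * (i : ℝ) ^ K := by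
      have h4 : (n : ℝ) ≤ ((i : ℝ) + 1) ^ (K + 1) := by exact_mod_cast hni.le
      have h5 := (le_abs_self _).trans (abs_pow_sub_pow_le ((i : ℝ) + 1) (i : ℝ) (K + 1))
      rw [add_sub_cancel_left, abs_one, one_mul, abs_of_pos hi0,
        abs_of_pos (by linarith : (0 : ℝ) < i + 1), max_eq_left (by linarith),
        Nat.add_sub_cancel] at h5
      have h6 : ((i : ℝ) + 1) ^ K ≤ (2 * i) ^ K := by gcongr; linarith
      rw [mul_pow] at h6
      push_cast at h5 ⊢
      calc (n : ℝ) - (i : ℝ) ^ (K + 1) ≤ ((i : ℝ) + 1) ^ (K + 1) - (i : ℝ) ^ (K + 1) := by linarith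
        _ ≤ (K + 1) * ((i : ℝ) + 1) ^ K := h5
        _ ≤ (K + 1) * (2 ^ K * (i : ℝ) ^ K) := by gcongr
        _ = _ := by ring
    calc _ ≤ 4 * Real.pi ^ 2 * (i : ℝ) ^ K + (K + 1) * 2 ^ K * (i : ℝ) ^ K := add_le_add h2 h3
      _ = C * (i : ℝ) ^ K := by rw [hC]; ring
  · rw [Real.sq_sqrt (by positivity)]
    push_cast
    field_simp
    ring

/-- The approximation failure at the `i`-th time of the grid. -/
def gridFailure (G : ℕ → Ω → ℂ) (K i : ℕ) : Set Ω :=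
  ⋃ n ∈ Finset.range ((i + 1) ^ (K + 1)), ⋃ q ∈ Finset.range (i ^ (4 * K + 5)),
    ⋃ u ∈ Finset.range (i ^ (K + 2)),
      {ω | i ^ (K + 1) ≤ n ∧ |(q : ℝ) / (i : ℝ) ^ (4 * K + 5) - (u : ℝ) / (i : ℝ) ^ (K + 2)| ≤
          1 / (i : ℝ) ^ (K + 2) ∧
        Real.sqrt ((i ^ (K + 1) : ℕ) : ℝ) ≤
          ‖angularWalk (fun j => G j ω) n ((q : ℝ) / (i : ℝ) ^ (4 * K + 5)) -
            angularWalk (fun j => G j ω) (i ^ (K + 1)) ((u : ℝ) / (i : ℝ) ^ (K + 2))‖}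

/-- Borel–Cantelli: polynomially many triples `(n, q, u)` against an exponentially small probability
for each. -/
theorem ae_eventually_notMem_gridFailure (hlaw : ∀ j, HasLaw (G j) stdComplexGaussian P)
    (hindep : iIndepFun G P) (K : ℕ) : ∀ᵐ ω ∂P, ∀ᶠ i in atTop, ω ∉ gridFailure G K i := by
  obtain ⟨c, hc, hgrid⟩ := measure_angularWalk_sub_grid_le hlaw hindep K
  have hle : ∀ i : ℕ, P (gridFailure G K i) ≤
      ENNReal.ofReal (2 ^ (K + 1) * ((i : ℝ) ^ (6 * K + 8) * Real.exp (-c * i))) := by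
    intro i
    rcases Nat.eq_zero_or_pos i with rfl | hi
    · simp [gridFailure]
    have hi1 : (1 : ℝ) ≤ i := by exact_mod_cast hi
    calc P (gridFailure G K i) ≤ ∑ _n ∈ Finset.range ((i + 1) ^ (K + 1)),
          ∑ _q ∈ Finset.range (i ^ (4 * K + 5)), ∑ _u ∈ Finset.range (i ^ (K + 2)),
            ENNReal.ofReal (Real.exp (-c * i)) := by
          refine (measure_biUnion_finset_le _ _).trans (Finset.sum_le_sum fun n hn => ?_)
          refine (measure_biUnion_finset_le _ _).trans (Finset.sum_le_sum fun q _ => ?_)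
          refine (measure_biUnion_finset_le _ _).trans (Finset.sum_le_sum fun u _ => ?_)
          by_cases h : i ^ (K + 1) ≤ n ∧ |(q : ℝ) / (i : ℝ) ^ (4 * K + 5) -
              (u : ℝ) / (i : ℝ) ^ (K + 2)| ≤ 1 / (i : ℝ) ^ (K + 2)
          · exact (measure_mono fun ω hω => hω.2.2).trans
              (hgrid i n hi h.1 (Finset.mem_range.1 hn) _ _ h.2)
          · refine (measure_mono (t := ∅) fun ω hω => h ⟨hω.1, hω.2.1⟩).trans ?_
            simp
      _ = ENNReal.ofReal ((((i : ℝ) + 1) ^ (K + 1) * ((i : ℝ) ^ (4 * K + 5) *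
            ((i : ℝ) ^ (K + 2) * Real.exp (-c * i))))) := by
          simp only [Finset.sum_const, Finset.card_range, nsmul_eq_mul]
          rw [ENNReal.ofReal_mul (by positivity), ENNReal.ofReal_mul (by positivity),
            ENNReal.ofReal_mul (by positivity), ENNReal.ofReal_pow (by positivity),
            ENNReal.ofReal_pow (by positivity), ENNReal.ofReal_pow (by positivity),
            ENNReal.ofReal_add (by positivity) one_pos.le]
          simp
      _ ≤ _ := by
          refine ENNReal.ofReal_le_ofReal ?_
          have h6 : ((i : ℝ) + 1) ^ (K + 1) ≤ 2 ^ (K + 1) * (i : ℝ) ^ (K + 1) := by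
            rw [← mul_pow]; gcongr; linarith
          calc _ ≤ 2 ^ (K + 1) * (i : ℝ) ^ (K + 1) * ((i : ℝ) ^ (4 * K + 5) *
                ((i : ℝ) ^ (K + 2) * Real.exp (-c * i))) := by gcongr
            _ = _ := by ring
  refine ae_eventually_notMem (ne_top_of_le_ne_top ?_ (ENNReal.tsum_le_tsum hle))
  rw [← ENNReal.ofReal_tsum_of_nonneg (fun i => by positivity)
    ((Real.summable_pow_mul_exp_neg_nat_mul _ hc).mul_left _)]
  exact ENNReal.ofReal_ne_top

theorem floor_div_mem {x : ℝ} (hx : x ∈ Set.Ico (0 : ℝ) 1) {L : ℕ} (hL : 0 < L) :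
    ⌊x * L⌋₊ < L ∧ (⌊x * L⌋₊ : ℝ) / L ≤ x ∧ x < ((⌊x * L⌋₊ : ℝ) + 1) / L := by
  have hL0 : (0 : ℝ) < L := by exact_mod_cast hL
  have hnn : 0 ≤ x * L := mul_nonneg hx.1 hL0.le
  refine ⟨(Nat.floor_lt hnn).2 (by nlinarith [hx.2]), ?_, ?_⟩
  · rw [div_le_iff₀ hL0]; exact Nat.floor_le hnn
  · rw [lt_div_iff₀ hL0]; exact Nat.lt_floor_add_one _

/-- Almost surely the walk is eventually close to its values on the polynomial grid. -/
theorem ae_eventually_norm_angularWalk_le (hlaw : ∀ j, HasLaw (G j) stdComplexGaussian P)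
    (hindep : iIndepFun G P) (K : ℕ) : ∀ᵐ ω ∂P, ∀ᶠ i : ℕ in atTop, ∀ n : ℕ, i ^ (K + 1) ≤ n →
      n < (i + 1) ^ (K + 1) → ∀ x ∈ Set.Ico (0 : ℝ) 1,
      ‖angularWalk (fun j => G j ω) n x‖ ≤ ‖angularWalk (fun j => G j ω) (i ^ (K + 1))
        ((⌊x * (i ^ (K + 2) : ℕ)⌋₊ : ℝ) / (i ^ (K + 2) : ℕ))‖ +
          2 * Real.sqrt ((i ^ (K + 1) : ℕ) : ℝ) := by
  filter_upwards [ae_eventually_notMem_gridFailure hlaw hindep K,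
    ae_eventually_sum_norm_le hlaw hindep] with ω hgrid hgrowth
  obtain ⟨n₀, hn₀⟩ := eventually_atTop.1 hgrowth
  filter_upwards [hgrid, eventually_ge_atTop n₀, eventually_ge_atTop 1,
    (tendsto_natCast_atTop_atTop (R := ℝ)).eventually_ge_atTop (2 * Real.pi * 2 ^ (4 * K + 4))]
    with i hi hin₀ hi1 hibig n hin hni x hx
  have hi0 : 0 < i := hi1
  have hi1' : (1 : ℝ) ≤ i := by exact_mod_cast hi1
  have hiR : (0 : ℝ) < i := by linarith
  obtain ⟨hu, hu1, hu2⟩ := floor_div_mem hx (pow_pos hi0 (K + 2))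
  obtain ⟨hq, hq1, hq2⟩ := floor_div_mem hx (pow_pos hi0 (4 * K + 5))
  set u := ⌊x * (i ^ (K + 2) : ℕ)⌋₊
  set q := ⌊x * (i ^ (4 * K + 5) : ℕ)⌋₊
  rw [add_div] at hu2 hq2
  push_cast at hu1 hu2 hq1 hq2
  have hLM : 1 / (i : ℝ) ^ (4 * K + 5) ≤ 1 / (i : ℝ) ^ (K + 2)  :=
    one_div_le_one_div_of_le (by positivity) (pow_le_pow_right₀ hi1' (by omega))
  have hclose : |(q : ℝ) / (i : ℝ) ^ (4 * K + 5) - (u : ℝ) / (i : ℝ) ^ (K + 2)| ≤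
      1 / (i : ℝ) ^ (K + 2) := by
    rw [abs_le]; constructor <;> linarith
  have h1 : ‖angularWalk (fun j => G j ω) n ((q : ℝ) / (i : ℝ) ^ (4 * K + 5)) -
      angularWalk (fun j => G j ω) (i ^ (K + 1)) ((u : ℝ) / (i : ℝ) ^ (K + 2))‖ <
      Real.sqrt ((i ^ (K + 1) : ℕ) : ℝ) := by
    by_contra! hcon
    apply hi
    simp only [gridFailure, Set.mem_iUnion, Finset.mem_range]
    exact ⟨n, hni, q, hq, u, hu, hin, hclose, hcon⟩
  have hn₀n : n₀ ≤ n := hin₀.trans ((Nat.le_self_pow (Nat.succ_ne_zero K) i).trans hin)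
  have h2 : ‖angularWalk (fun j => G j ω) n x -
      angularWalk (fun j => G j ω) n ((q : ℝ) / (i : ℝ) ^ (4 * K + 5))‖ ≤ 1 := by
    -- The Lipschitz constant in the angle is at most `2πn⁴`, of order `i^(4K+4)`; this is why the
    -- fine mesh is `i^(-(4K+5))`.
    refine (norm_angularWalk_sub_le _ _ _ _).trans ?_
    have h3 : |x - (q : ℝ) / (i : ℝ) ^ (4 * K + 5)| ≤ 1 / (i : ℝ) ^ (4 * K + 5) := by
      rw [abs_le]; constructor <;> linarith
    have h4 : (n : ℝ) ≤ 2 ^ (K + 1) * (i : ℝ) ^ (K + 1) := by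
      rw [← mul_pow]
      calc (n : ℝ) ≤ ((i : ℝ) + 1) ^ (K + 1) := by exact_mod_cast hni.le
        _ ≤ _ := by gcongr; linarith
    calc _ ≤ (n : ℝ) ^ 3 * (2 * Real.pi * n * (1 / (i : ℝ) ^ (4 * K + 5))) := by
          gcongr
          exact hn₀ n hn₀n
      _ = 2 * Real.pi * (n : ℝ) ^ 4 * (1 / (i : ℝ) ^ (4 * K + 5)) := by ring
      _ ≤ 2 * Real.pi * (2 ^ (K + 1) * (i : ℝ) ^ (K + 1)) ^ 4 * (1 / (i : ℝ) ^ (4 * K + 5)) := by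
          gcongr
      _ = 2 * Real.pi * 2 ^ (4 * K + 4) / i := by field_simp; ring
      _ ≤ 1 := (div_le_one hiR).2 hibig
  have h5 : 1 ≤ Real.sqrt ((i ^ (K + 1) : ℕ) : ℝ) := by
    rw [Real.one_le_sqrt]
    exact_mod_cast Nat.one_le_pow _ _ hi0
  push_cast at h1 h5 ⊢
  have h6 := norm_sub_norm_le (angularWalk (fun j => G j ω) n x)
    (angularWalk (fun j => G j ω) n ((q : ℝ) / (i : ℝ) ^ (4 * K + 5)))
  have h7 := norm_sub_norm_le (angularWalk (fun j => G j ω) n ((q : ℝ) / (i : ℝ) ^ (4 * K + 5)))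
    (angularWalk (fun j => G j ω) (i ^ (K + 1)) ((u : ℝ) / (i : ℝ) ^ (K + 2)))
  linarith

end UpperBound

/-! ### Upper bound: covering, and conclusion -/

section Final

variable {Ω : Type*} [MeasurableSpace Ω] {P : Measure Ω} {G : ℕ → Ω → ℂ}

/-- The grid cell of index `q` at the `i`-th scale carries a large value of the walk. -/
def largeCell (G : ℕ → Ω → ℂ) (β : ℝ) (K i q : ℕ) : Set Ω :=
  {ω | threshold β (i ^ (K + 1)) ≤
    ‖angularWalk (fun j => G j ω) (i ^ (K + 1)) ((q : ℝ) / (i ^ (K + 2) : ℕ))‖}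

theorem measure_largeCell_le (hlaw : ∀ j, HasLaw (G j) stdComplexGaussian P)
    (hindep : iIndepFun G P) {β : ℝ} (hβ : 0 < β) (K : ℕ) {i : ℕ} (hi : 1 ≤ i) (q : ℕ) :
    P (largeCell G β K i q) ≤ ENNReal.ofReal ((i : ℝ) ^ (-((K + 1) * β))) := by
  have hi0 : (0 : ℝ) < i := by exact_mod_cast hi
  have hn : (0 : ℝ) < ((i ^ (K + 1) : ℕ) : ℝ) := by exact_mod_cast pow_pos (by omega) _
  refine (measure_norm_sum_mul_ge_le hlaw hindep (Finset.range (i ^ (K + 1)))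
    (circleWeight ((q : ℝ) / (i ^ (K + 2) : ℕ))) (v := ((i ^ (K + 1) : ℕ) : ℝ))
    (by simp [norm_circleWeight]) (Real.sqrt_nonneg _)).trans
    (ENNReal.ofReal_le_ofReal (le_of_eq ?_))
  rw [Real.sq_sqrt (by have := Real.log_natCast_nonneg (i ^ (K + 1)); positivity),
    Real.rpow_def_of_pos hi0]
  congr 1
  have h1 : Real.log ((i ^ (K + 1) : ℕ) : ℝ) = (K + 1) * Real.log i := by
    push_cast
    rw [Real.log_pow]
    push_cast; ring
  rw [h1]
  field_simp

theorem measurableSet_largeCell (hG : ∀ j, Measurable (G j)) (β : ℝ) (K i q : ℕ) :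
    MeasurableSet (largeCell G β K i q) := by
  refine measurableSet_le measurable_const (Measurable.norm ?_)
  simp only [angularWalk_eq]
  exact Finset.measurable_fun_sum _ fun j _ => (hG j).mul_const _

open Classical in
/-- The total `s`-cost of the grid cells that carry a large value of the walk is finite. -/
theorem ae_tsum_largeCell_ne_top (hG : ∀ j, Measurable (G j))
    (hlaw : ∀ j, HasLaw (G j) stdComplexGaussian P) (hindep : iIndepFun G P)
    {β s : ℝ} (hβ : 0 < β) {K : ℕ} (hK : (K + 2) * (1 - s) - (K + 1) * β < -1) :
    ∀ᵐ ω ∂P, ∑' i : ℕ, ∑ q ∈ Finset.range (i ^ (K + 2)),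
      (if ω ∈ largeCell G β K i q then ENNReal.ofReal (((i : ℝ) ^ (-((K + 2) * s)))) else 0) ≠ ∞ := by
  have hm : ∀ i q, Measurable fun ω => if ω ∈ largeCell G β K i q then
      ENNReal.ofReal (((i : ℝ) ^ (-((K + 2) * s)))) else 0 := fun i q =>
    Measurable.ite (measurableSet_largeCell hG β K i q) measurable_const measurable_const
  have hm' : ∀ i : ℕ, Measurable fun ω => ∑ q ∈ Finset.range (i ^ (K + 2)),
      (if ω ∈ largeCell G β K i q then ENNReal.ofReal (((i : ℝ) ^ (-((K + 2) * s)))) else 0) :=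
    fun i => Finset.measurable_fun_sum _ fun q _ => hm i q
  have hint : ∫⁻ ω, ∑' i : ℕ, ∑ q ∈ Finset.range (i ^ (K + 2)),
      (if ω ∈ largeCell G β K i q then ENNReal.ofReal (((i : ℝ) ^ (-((K + 2) * s)))) else 0) ∂P
      ≠ ∞ := by
    rw [lintegral_tsum fun i => (hm' i).aemeasurable]
    -- There are `i^(K+2)` cells, each of cost `i^(-(K+2)s)` and of probability at most
    -- `i^(-(K+1)β)`; `hK` makes the resulting power of `i` summable.
    have hle : ∀ i : ℕ, ∫⁻ ω, ∑ q ∈ Finset.range (i ^ (K + 2)),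
        (if ω ∈ largeCell G β K i q then ENNReal.ofReal (((i : ℝ) ^ (-((K + 2) * s)))) else 0) ∂P ≤
        ENNReal.ofReal ((i : ℝ) ^ ((K + 2) * (1 - s) - (K + 1) * β)) := by
      intro i
      rcases Nat.eq_zero_or_pos i with rfl | hi
      · simp
      have hi0 : (0 : ℝ) < i := by exact_mod_cast hi
      rw [lintegral_finsetSum _ fun q _ => hm i q]
      calc _ ≤ ∑ _q ∈ Finset.range (i ^ (K + 2)), ENNReal.ofReal ((i : ℝ) ^ (-((K + 2) * s))) *
            ENNReal.ofReal ((i : ℝ) ^ (-((K + 1) * β))) := by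
            refine Finset.sum_le_sum fun q _ => ?_
            have h1 : (fun ω => if ω ∈ largeCell G β K i q then
                ENNReal.ofReal (((i : ℝ) ^ (-((K + 2) * s)))) else 0) =
                (largeCell G β K i q).indicator
                  fun _ => ENNReal.ofReal (((i : ℝ) ^ (-((K + 2) * s)))) := by
              ext ω; simp [Set.indicator]
            rw [h1, lintegral_indicator_const (measurableSet_largeCell hG β K i q)]
            gcongr
            exact measure_largeCell_le hlaw hindep hβ K hi q
        _ = _ := by
            rw [Finset.sum_const, Finset.card_range, nsmul_eq_mul,
              ← ENNReal.ofReal_mul (by positivity), ← ENNReal.ofReal_natCast,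
              ← ENNReal.ofReal_mul (by positivity)]
            congr 1
            push_cast
            rw [← Real.rpow_natCast, ← Real.rpow_add hi0, ← Real.rpow_add hi0]
            congr 1
            push_cast; ring
    refine ne_top_of_le_ne_top ?_ (ENNReal.tsum_le_tsum hle)
    rw [← ENNReal.ofReal_tsum_of_nonneg (fun i => by positivity) (Real.summable_nat_rpow.2 hK)]
    exact ENNReal.ofReal_ne_top
  filter_upwards [ae_lt_top (Measurable.tsum hm') hint] with ω hω using hω.ne

/-- The approximation error `2√n` lacks the factor `√(log n)` and is absorbed by the gap between the
thresholds. -/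
theorem eventually_threshold_add_two_sqrt_le {α β : ℝ} (hβ : 0 ≤ β) (hαβ : β < α) :
    ∀ᶠ n : ℕ in atTop, threshold β n + 2 * Real.sqrt n ≤ threshold α n := by
  have hs : 0 < Real.sqrt (2 * α) - Real.sqrt (2 * β) :=
    sub_pos.2 (Real.sqrt_lt_sqrt (by positivity) (by linarith))
  have hlog : Tendsto (fun N : ℕ => Real.sqrt (Real.log N)) atTop atTop :=
    Real.tendsto_sqrt_atTop.comp (Real.tendsto_log_atTop.comp tendsto_natCast_atTop_atTop)
  filter_upwards [hlog.eventually_ge_atTop (2 / (Real.sqrt (2 * α) - Real.sqrt (2 * β)))] with n hn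
  rw [div_le_iff₀ hs] at hn
  have h1 : ∀ γ : ℝ, 0 ≤ γ → threshold γ n =
      Real.sqrt (2 * γ) * Real.sqrt (Real.log n) * Real.sqrt n := by
    intro γ hγ
    have hl := Real.log_natCast_nonneg n
    rw [threshold, ← Real.sqrt_mul (by positivity), ← Real.sqrt_mul (by positivity)]
    congr 1; ring
  rw [h1 β hβ, h1 α (hβ.trans hαβ.le)]
  nlinarith [mul_le_mul_of_nonneg_right hn (Real.sqrt_nonneg (n : ℝ))]

theorem threshold_mono {α : ℝ} (hα : 0 ≤ α) {m n : ℕ} (hm : 1 ≤ m) (hmn : m ≤ n) :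
    threshold α m ≤ threshold α n := by
  have hm0 : (0 : ℝ) < m := by exact_mod_cast hm
  have h1 : (m : ℝ) ≤ n := by exact_mod_cast hmn
  have h2 := Real.log_natCast_nonneg m
  unfold threshold
  gcongr

theorem ae_dimH_le_of_measurable (hG : ∀ j, Measurable (G j))
    (hlaw : ∀ j, HasLaw (G j) stdComplexGaussian P) (hindep : iIndepFun G P)
    {α s : ℝ} (hs : 0 < s) (hα : 0 < α) (hsα : 1 - α < s) :
    ∀ᵐ ω ∂P, dimH (exceptionalAngles α fun j => G j ω) ≤ ENNReal.ofReal s := by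
  classical
  -- The cost exponent is `(K+1)(1 - s - β) + (1 - s)`. Taking `β < α` with `β + s > 1` makes its
  -- slope in `K` negative, so a large `K` brings it below `-1`.
  obtain ⟨β, hβ, hβα⟩ : ∃ β, max 0 (1 - s) < β ∧ β < α :=
    exists_between (max_lt hα (by linarith))
  have hβ0 : 0 < β := (le_max_left _ _).trans_lt hβ
  have hβs : 0 < β + s - 1 := by have := (le_max_right 0 (1 - s)).trans_lt hβ; linarith
  obtain ⟨K, hK⟩ : ∃ K : ℕ, 2 / (β + s - 1) ≤ K := exists_nat_ge _
  rw [div_le_iff₀ hβs] at hK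
  have hK' : ((K : ℝ) + 2) * (1 - s) - (K + 1) * β < -1 := by nlinarith
  filter_upwards [ae_tsum_largeCell_ne_top hG hlaw hindep hβ0 hK',
    ae_eventually_norm_angularWalk_le hlaw hindep K] with ω hfin happrox
  have hpow : Tendsto (fun i : ℕ => i ^ (K + 1)) atTop atTop :=
    tendsto_pow_atTop (Nat.succ_ne_zero K)
  have hthr := hpow.eventually (eventually_threshold_add_two_sqrt_le hβ0.le hβα)
  obtain ⟨i₀, hi₀⟩ := eventually_atTop.1 (happrox.and (hthr.and (eventually_ge_atTop 1)))
  -- The large cells of all scales `i ≥ m` cover the exceptional set, with diameters tending to `0`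
  -- as `m` grows and cost at most the full finite sum. Finite `s`-dimensional measure is all that
  -- is needed.
  set t : ℕ → ℕ × ℕ → Set ℝ := fun m iq =>
    if m ≤ iq.1 ∧ iq.2 < iq.1 ^ (K + 2) ∧ ω ∈ largeCell G β K iq.1 iq.2 then
      Set.Icc ((iq.2 : ℝ) / (iq.1 ^ (K + 2) : ℕ)) (((iq.2 : ℝ) + 1) / (iq.1 ^ (K + 2) : ℕ))
    else ∅ with ht
  have hdiam : ∀ m iq, Metric.ediam (t m iq) = if m ≤ iq.1 ∧ iq.2 < iq.1 ^ (K + 2) ∧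
      ω ∈ largeCell G β K iq.1 iq.2 then ENNReal.ofReal (1 / (iq.1 ^ (K + 2) : ℕ)) else 0 := by
    intro m iq
    simp only [ht]
    split_ifs
    · rw [Real.ediam_Icc]; congr 1; ring
    · simp
  have hcover : ∀ m, i₀ ≤ m →
      (exceptionalAngles α fun j => G j ω) ⊆ ⋃ iq, t m iq := by
    rintro m hm x ⟨hx, hfreq⟩
    obtain ⟨n, hn, hlarge⟩ := frequently_atTop.1 hfreq (m ^ (K + 1))
    obtain ⟨i, him, hin, hni⟩ := exists_pow_le_lt_pow m hn
    obtain ⟨h1, h2, h3⟩ := hi₀ i (hm.trans him)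
    have h4 := h1 n hin hni x hx
    have h5 := threshold_mono hα.le (Nat.one_le_pow (K + 1) i h3) hin
    obtain ⟨hu, hu1, hu2⟩ := floor_div_mem hx (pow_pos h3 (K + 2))
    refine Set.mem_iUnion.2 ⟨(i, ⌊x * (i ^ (K + 2) : ℕ)⌋₊), ?_⟩
    have hcell : ω ∈ largeCell G β K i ⌊x * (i ^ (K + 2) : ℕ)⌋₊ := by
      change threshold β (i ^ (K + 1)) ≤ _
      linarith
    simp only [ht]
    rw [if_pos ⟨him, hu, hcell⟩]
    exact ⟨hu1, hu2.le⟩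
  have hr : Tendsto (fun m : ℕ => ENNReal.ofReal (1 / ((m ^ (K + 2) : ℕ) : ℝ))) atTop (𝓝 0) := by
    have h1 : Tendsto (fun m : ℕ => 1 / ((m ^ (K + 2) : ℕ) : ℝ)) atTop (𝓝 0) := by
      simp only [one_div]
      exact tendsto_inv_atTop_zero.comp (tendsto_natCast_atTop_atTop.comp
        (tendsto_pow_atTop (Nat.succ_ne_zero (K + 1))))
    exact ENNReal.ofReal_zero ▸ ENNReal.tendsto_ofReal h1
  have hH := Measure.hausdorffMeasure_le_liminf_tsum s
    (exceptionalAngles α fun j => G j ω) (l := atTop) _ hr t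
    (by
      filter_upwards [eventually_ge_atTop 1] with m hm iq
      rw [hdiam]
      split_ifs with h
      · refine ENNReal.ofReal_le_ofReal (one_div_le_one_div_of_le ?_ ?_)
        · exact_mod_cast pow_pos hm _
        · exact_mod_cast Nat.pow_le_pow_left h.1 _
      · exact zero_le)
    ((eventually_ge_atTop i₀).mono fun m hm => hcover m hm)
  have hbound : ∀ m, ∑' iq, Metric.ediam (t m iq) ^ s ≤
      ∑' i : ℕ, ∑ q ∈ Finset.range (i ^ (K + 2)),
        (if ω ∈ largeCell G β K i q then
          ENNReal.ofReal (((i : ℝ) ^ (-((K + 2) * s)))) else 0) := by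
    intro m
    rw [ENNReal.tsum_prod']
    refine ENNReal.tsum_le_tsum fun i => ?_
    rw [tsum_eq_sum (s := Finset.range (i ^ (K + 2)))]
    · refine Finset.sum_le_sum fun q hq => ?_
      have hi : 0 < i := by
        by_contra! h
        have : i = 0 := by omega
        subst this
        simp at hq
      have hi0 : (0 : ℝ) < i := by exact_mod_cast hi
      rw [hdiam]
      by_cases hc : ω ∈ largeCell G β K i q
      · rw [if_pos hc]
        split_ifs
        · rw [ENNReal.ofReal_rpow_of_pos (by positivity)]
          refine ENNReal.ofReal_le_ofReal (le_of_eq ?_)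
          push_cast
          rw [one_div, Real.inv_rpow (by positivity), ← Real.rpow_neg (by positivity),
            ← Real.rpow_natCast, ← Real.rpow_mul hi0.le]
          congr 1
          push_cast; ring
        · rw [ENNReal.zero_rpow_of_pos hs]; exact zero_le
      · rw [if_neg hc, if_neg (fun h => hc h.2.2), ENNReal.zero_rpow_of_pos hs]
    · intro q hq
      rw [hdiam, if_neg (fun h => hq (Finset.mem_range.2 h.2.1)), ENNReal.zero_rpow_of_pos hs]
  have hne : μH[((Real.toNNReal s : NNReal) : ℝ)]
      (exceptionalAngles α fun j => G j ω) ≠ ∞ := by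
    rw [Real.coe_toNNReal s hs.le]
    refine ne_top_of_le_ne_top hfin (hH.trans ?_)
    exact (liminf_le_liminf (Eventually.of_forall hbound)).trans (by simp)
  exact dimH_le_of_hausdorffMeasure_ne_top hne

theorem ae_dimH_eq_of_measurable (hG : ∀ j, Measurable (G j))
    (hlaw : ∀ j, HasLaw (G j) stdComplexGaussian P) (hindep : iIndepFun G P)
    {α : ℝ} (hα : 0 < α) :
    ∀ᵐ ω ∂P, dimH (exceptionalAngles α fun j => G j ω) = ENNReal.ofReal (max (1 - α) 0) := by
  set d : ℝ := max (1 - α) 0 with hd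
  have hd0 : 0 ≤ d := le_max_right _ _
  have hupper : ∀ᵐ ω ∂P, ∀ m : ℕ, dimH (exceptionalAngles α fun j => G j ω) ≤
      ENNReal.ofReal (d + 1 / (m + 1)) := by
    refine ae_all_iff.2 fun m => ?_
    have hm : (0 : ℝ) < 1 / (m + 1) := by positivity
    refine ae_dimH_le_of_measurable hG hlaw hindep (by linarith) hα ?_
    have := le_max_left (1 - α) 0
    linarith
  have hlower : ∀ᵐ ω ∂P, ∀ m : ℕ, ENNReal.ofReal (d - 1 / (m + 1)) ≤
      dimH (exceptionalAngles α fun j => G j ω) := by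
    refine ae_all_iff.2 fun m => ?_
    -- Either the bound is trivial, or `d > 0`, which forces `d = 1 - α`.
    rcases le_or_gt (d - 1 / (m + 1)) 0 with h | h
    · refine Eventually.of_forall fun ω => ?_
      rw [ENNReal.ofReal_of_nonpos h]
      exact zero_le
    · refine ae_le_dimH_of_measurable hG hlaw hindep hα h ?_
      have hm : (0 : ℝ) < 1 / (m + 1) := by positivity
      have hd1 : d = 1 - α := max_eq_left (by
        by_contra! hneg
        rw [hd, max_eq_right hneg.le] at h
        linarith)
      linarith
  have hlim : Tendsto (fun m : ℕ => (1 : ℝ) / (m + 1)) atTop (𝓝 0) :=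
    tendsto_one_div_add_atTop_nhds_zero_nat
  filter_upwards [hupper, hlower] with ω hu hl
  refine le_antisymm ?_ ?_
  · have := ENNReal.tendsto_ofReal (hlim.const_add d)
    rw [add_zero] at this
    exact ge_of_tendsto' this hu
  · have := ENNReal.tendsto_ofReal (hlim.const_sub d)
    rw [sub_zero] at this
    exact le_of_tendsto' this hl

end Final

theorem mainTheorem2 {Ω : Type*} [MeasurableSpace Ω] (P : Measure Ω) [IsProbabilityMeasure P]
    (G : ℕ → Ω → ℂ) (hG_law : ∀ j : ℕ, HasLaw (G j) stdComplexGaussian P)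
    (hG_indep : iIndepFun G P) (α : ℝ) (hα : 0 < α) :
    ∀ᵐ ω ∂P,
      dimH (exceptionalAngles α (fun j : ℕ => G j ω)) = ENNReal.ofReal (max (1 - α) 0) := by
  -- `HasLaw` only gives almost everywhere measurability; countably many measurable modifications
  -- change the walks on a null set only.
  have hm : ∀ j, AEMeasurable (G j) P := fun j => (hG_law j).aemeasurable
  have hlaw : ∀ j, HasLaw ((hm j).mk (G j)) stdComplexGaussian P := fun j =>
    (hG_law j).congr (hm j).ae_eq_mk.symm
  have hindep : iIndepFun (fun j => (hm j).mk (G j)) P :=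
    hG_indep.congr fun j => (hm j).ae_eq_mk
  filter_upwards [ae_dimH_eq_of_measurable (fun j => (hm j).measurable_mk) hlaw hindep hα,
    ae_all_iff.2 fun j => (hm j).ae_eq_mk] with ω hω heq
  rw [← hω]
  congr 2
  funext j
  exact heq j
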